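/- Let $\mathcal H$ be an infinite-dimensional complex Hilbert space with Hermitian product $\langle\langle\cdot,\cdot\rangle\rangle$ and real scalar product $\langle\cdot,\cdot\rangle=\mathrm{Re}\,\langle\langle\cdot,\cdot\rangle\rangle$. Let $\mathbb S=\{\varphi\in\mathcal H:\|\varphi\|=\sqrt2\}$, a submanifold of the underlying real Hilbert space, let $\rho_\theta\varphi=e^{i\theta}\varphi$ for $\theta\in\mathbb R$, and let $[\varphi]=\{\rho_\theta\varphi:\theta\in\mathbb R\}$ be the $\mathbb S^1$-orbit of $\varphi\in\mathbb S$. Orthogonality of vectors refers to $\langle\cdot,\cdot\rangle$, and two orbits are orthogonal if every vector of the first is orthogonal to every vector of the second. Fix $k\in\{1,2,\dots,\infty\}$; "differentiable" means of class $C^k$, and a diffeomorphism $\mathbb S\to\mathbb S$ is a bijection that is of class $C^k$ together with its inverse. A diffeomorphism $\nu:\mathbb S\to\mathbb S$ is an internal equivalence if it maps every $\mathbb S^1$-orbit into itself and $\nu\circ\rho_\theta=\rho_\theta\circ\nu$ for all $\theta$. A diffeomorphism $U:\mathbb S\to\mathbb S$ is a Hilbert automorphism if $U\circ\rho_\theta=\rho_\theta\circ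 U$ for all $\theta$, $U$ maps orthogonal vectors to orthogonal vectors, and $U(\cos t\cdot\varphi+\sin t\cdot\psi)=\cos t\cdot U(\varphi)+\sin t\cdot U(\psi)$ for all orthogonal $\varphi,\psi\in\mathbb S$ and all $t\in\mathbb R$. A diffeomorphism $\Phi:\mathbb S\to\mathbb S$ is a semi-automorphism of $\mathbb S$ if $\Phi\circ\rho_\theta=\rho_\theta\circ\Phi$ for all $\theta$ and $\Phi$ maps every pair of orthogonal $\mathbb S^1$-orbits to a pair of orthogonal $\mathbb S^1$-orbits. Then: 1. The set $\Theta Aut(\mathbb S)$ of all semi-automorphisms is a group under composition. 2. There is a unique group homomorphism $\sigma:\Theta Aut(\mathbb S)\to\{1,-1\}$ such that $\sigma(\Phi)=1$ if and only if $\Phi=\Psi^2\circ\Gamma^2$ for some $\Psi,\Gamma\in\Theta Aut(\mathbb S)$. For $\Phi\in\Theta Aut(\mathbb S)$ one has $\sigma(\Phi)=1$ (respectively $\sigma(\Phi)=-1$) if and only if there is a unitary (respectively antiunitary) map $\mathcal U:\mathcal H\to\mathcal H$ such that, for every $\varphi\in\mathbb S$, $\Phi(\varphi)=c\cdot\mathcal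 U\varphi$ for some complex number $c$ with $|c|=1$ depending on $\varphi$. 3. Call a semi-automorphism $\Phi$ with $\sigma(\Phi)=1$ an automorphism of $\mathbb S$. A diffeomorphism $\Phi:\mathbb S\to\mathbb S$ is an automorphism of $\mathbb S$ if and only if $\Phi=U\circ\nu$ for some Hilbert automorphism $U$ and some internal equivalence $\nu$. 4. A diffeomorphism $\Phi:\mathbb S\to\mathbb S$ is an automorphism of $\mathbb S$ if and only if there are a unitary map $\mathcal U:\mathcal H\to\mathcal H$ and a differentiable function $h:\mathbb S\to\mathbb R$, constant on the $\mathbb S^1$-orbits, such that $\Phi(\varphi)=\mathcal U\big(e^{-ih(\varphi)}\varphi\big)$ for all $\varphi\in\mathbb S$. -/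

import Mathlib

noncomputable section

namespace HiddenPhase

variable {H : Type*} [NormedAddCommGroup H] [InnerProductSpace ℂ H]

/-- The state space `𝕊`: the sphere of radius `√2` of the Hilbert space. -/
abbrev State (H : Type*) [NormedAddCommGroup H] : Type _ :=
  Metric.sphere (0 : H) (Real.sqrt 2)

/-- The real scalar product `⟨φ, ψ⟩`, i.e. the real part of the hermitian product. -/
def realInner (φ ψ : H) : ℝ := (inner ℂ φ ψ).re

/-- The action `ρ_θ φ = e^{iθ} φ` of the circle on `𝕊`. -/
def rho (θ : ℝ) (φ : State H) : State H :=
  ⟨Complex.exp (θ * Complex.I) • (φ : H), by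
    have h := φ.2
    rw [mem_sphere_zero_iff_norm] at h ⊢
    rw [norm_smul, Complex.norm_exp_ofReal_mul_I, one_mul, h]⟩

/-- The `S¹`-orbit `[φ] = {ρ_θ φ : θ ∈ ℝ}`. -/
def orbit (φ : State H) : Set (State H) := Set.range fun θ : ℝ => rho θ φ

/-- Two subsets of `𝕊` are orthogonal if all their elements are, for the real product. -/
def OrthSets (A B : Set (State H)) : Prop :=
  ∀ a ∈ A, ∀ b ∈ B, realInner (a : H) (b : H) = 0

/-- `f` is of class `C^k` on the submanifold `𝕊` of the real Hilbert space underlying `H`: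
locally it is the restriction of a `C^k` map defined on an open subset of `H`. -/
def IsCk {F : Type*} [NormedAddCommGroup F] [NormedSpace ℝ F] (k : ℕ∞) (f : State H → F) :
    Prop :=
  ∀ φ : State H, ∃ W : Set H, IsOpen W ∧ (φ : H) ∈ W ∧
    ∃ g : H → F, ContDiffOn ℝ k g W ∧ ∀ ψ : State H, (ψ : H) ∈ W → g ψ = f ψ

/-- `Φ` is a `C^k` diffeomorphism of `𝕊`. -/
def IsDiffeo (k : ℕ∞) (Φ : Equiv.Perm (State H)) : Prop :=
  IsCk k (fun φ => (Φ φ : H)) ∧ IsCk k (fun φ => (Φ.symm φ : H))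

/-- `Φ` commutes with every `ρ_θ`. -/
def CommutesWithPhase (Φ : Equiv.Perm (State H)) : Prop :=
  ∀ (θ : ℝ) (φ : State H), Φ (rho θ φ) = rho θ (Φ φ)

/-- Internal equivalences. -/
structure IsInternalEquivalence (k : ℕ∞) (ν : Equiv.Perm (State H)) : Prop where
  diffeo : IsDiffeo k ν
  orbit_into_itself : ∀ φ : State H, ν '' orbit φ ⊆ orbit φ
  commutes : CommutesWithPhase ν

/-- Hilbert automorphisms of `𝕊`. -/
structure IsHilbertAutomorphism (k : ℕ∞) (U : Equiv.Perm (State H)) : Prop where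
  diffeo : IsDiffeo k U
  commutes : CommutesWithPhase U
  orthogonality : ∀ φ ψ : State H, realInner (φ : H) (ψ : H) = 0 →
    realInner (U φ : H) (U ψ : H) = 0
  /-- `χ` is the superposition `cos t • φ + sin t • ψ`, which lies in `𝕊` as `φ ⟂ ψ`. -/
  superposition : ∀ φ ψ : State H, realInner (φ : H) (ψ : H) = 0 → ∀ (t : ℝ) (χ : State H),
    (χ : H) = Real.cos t • (φ : H) + Real.sin t • (ψ : H) →
    (U χ : H) = Real.cos t • (U φ : H) + Real.sin t • (U ψ : H)

/-- Semi-automorphisms of `𝕊`. -/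
structure IsSemiAutomorphism (k : ℕ∞) (Φ : Equiv.Perm (State H)) : Prop where
  diffeo : IsDiffeo k Φ
  commutes : CommutesWithPhase Φ
  orthogonality : ∀ φ ψ : State H, OrthSets (orbit φ) (orbit ψ) →
    OrthSets (Φ '' orbit φ) (Φ '' orbit ψ)

/-- The property that characterizes the sign on a group `Θ` of transformations of `𝕊`:
`σ Φ = 1` exactly when `Φ = Ψ² ∘ Γ²` with `Ψ`, `Γ` in `Θ`. -/
def IsSign {Θ : Subgroup (Equiv.Perm (State H))} (σ : Θ →* ℤˣ) : Prop :=
  ∀ Φ : Θ, σ Φ = 1 ↔ ∃ Ψ Γ : Θ, Φ = Ψ ^ 2 * Γ ^ 2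

/-- Automorphisms of `𝕊`: the elements of `Θ` (the group of semi-automorphisms) of sign `1`. -/
def IsAutomorphism {Θ : Subgroup (Equiv.Perm (State H))} (σ : Θ →* ℤˣ)
    (Φ : Equiv.Perm (State H)) : Prop :=
  ∃ hΦ : Φ ∈ Θ, σ ⟨Φ, hΦ⟩ = 1

/-- Up to a phase depending on the point, `Φ` is the restriction of a unitary map. -/
def IsUnitaryType (Φ : Equiv.Perm (State H)) : Prop :=
  ∃ V : H ≃ₗᵢ[ℂ] H, ∀ φ : State H, ∃ c : ℂ, ‖c‖ = 1 ∧ (Φ φ : H) = c • V (φ : H)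

/-- Up to a phase depending on the point, `Φ` is the restriction of an antiunitary map. -/
def IsAntiunitaryType (Φ : Equiv.Perm (State H)) : Prop :=
  ∃ V : H ≃ₛₗᵢ[starRingEnd ℂ] H, ∀ φ : State H, ∃ c : ℂ, ‖c‖ = 1 ∧ (Φ φ : H) = c • V (φ : H)

end HiddenPhase

end

/-!
Extend a semi-automorphism `Φ` to a positively homogeneous bijection `F` of `H`. As the derivatives
of `F` are surjective, being the image of a vector orthogonal to `x` is an open and closed condition
on the nonzero vectors orthogonal to `F x`, which form a connected set. Hence `F` preserves
orthogonality in both directions, and `Φ⁻¹` is again a semi-automorphism.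

By Uhlhorn's argument, `F` becomes real linear in the affine charts `x ↦ e + x` of projective space,
where it sends `i x` to `± i` times the image of `x`, with a constant sign. This gives
`Φ φ = c φ • V φ` with `V` unitary or antiunitary and `c` continuous with values in the unit circle.
The sphere being simply connected, `c φ = exp (i h φ)` with `h` continuous. Along an orbit `h` is
constant if `V` is unitary, while it would grow like `2 θ` if `V` were antiunitary, although `ρ_θ`
is periodic in `θ`. So only the unitary case occurs, and the semi-automorphisms are the maps
`φ ↦ V (exp (-i h φ) • φ)` with `V` unitary and `h` of class `C^k` and constant on the orbits.

Unitary maps have unitary square roots and `h` can be halved, so every semi-automorphism is a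
product of two squares: the sign is trivial.
-/

noncomputable section

namespace HiddenPhase

section Phase

variable {H : Type*} [NormedAddCommGroup H] [InnerProductSpace ℂ H]
  {φ ψ : State H} {Φ Ψ : Equiv.Perm (State H)}

@[simp] theorem State.norm_eq {E : Type*} [NormedAddCommGroup E] (φ : State E) :
    ‖(φ : E)‖ = √2 :=
  mem_sphere_zero_iff_norm.1 φ.2

theorem State.coe_ne_zero {E : Type*} [NormedAddCommGroup E] (φ : State E) : (φ : E) ≠ 0 := by
  rw [← norm_ne_zero_iff, φ.norm_eq]
  positivity

@[simp] theorem coe_rho (θ : ℝ) (φ : State H) :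
    (rho θ φ : H) = Complex.exp (θ * Complex.I) • (φ : H) := rfl

theorem coe_rho_pi_div_two (φ : State H) :
    (rho (Real.pi / 2) φ : H) = Complex.I • (φ : H) := by
  rw [coe_rho, Complex.ofReal_div, Complex.ofReal_ofNat, Complex.exp_pi_div_two_mul_I]

theorem mem_orbit_self (φ : State H) : φ ∈ orbit φ := ⟨0, by ext; simp⟩

theorem orthSets_orbit_iff : OrthSets (orbit φ) (orbit ψ) ↔ inner ℂ (φ : H) (ψ : H) = 0 := by
  constructor
  · intro h
    have h_re := h φ (mem_orbit_self φ) ψ (mem_orbit_self ψ)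
    have h_im := h φ (mem_orbit_self φ) _ ⟨Real.pi / 2, rfl⟩
    rw [realInner, coe_rho_pi_div_two, inner_smul_right] at h_im
    exact Complex.ext h_re (by simpa using h_im)
  · rintro h _ ⟨s, rfl⟩ _ ⟨t, rfl⟩
    simp [realInner, h]

theorem CommutesWithPhase.map_smul (hΦ : CommutesWithPhase Φ) {c : ℂ} (hc : ‖c‖ = 1)
    (h : (ψ : H) = c • (φ : H)) : (Φ ψ : H) = c • (Φ φ : H) := by
  obtain ⟨θ, rfl⟩ := (Complex.norm_eq_one_iff c).1 hc
  obtain rfl : ψ = rho θ φ := Subtype.ext h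
  rw [hΦ θ φ, coe_rho]

theorem CommutesWithPhase.mul (hΦ : CommutesWithPhase Φ) (hΨ : CommutesWithPhase Ψ) :
    CommutesWithPhase (Φ * Ψ) := fun θ φ => by
  rw [Equiv.Perm.mul_apply, hΨ, hΦ, Equiv.Perm.mul_apply]

theorem CommutesWithPhase.image_orbit (hΦ : CommutesWithPhase Φ) (φ : State H) :
    Φ '' orbit φ = orbit (Φ φ) := by
  rw [orbit, orbit, ← Set.range_comp]
  exact congrArg Set.range (funext fun θ => hΦ θ φ)

theorem CommutesWithPhase.orthSets_image_orbit_iff (hΦ : CommutesWithPhase Φ) :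
    OrthSets (Φ '' orbit φ) (Φ '' orbit ψ) ↔ inner ℂ (Φ φ : H) (Φ ψ : H) = 0 := by
  rw [hΦ.image_orbit, hΦ.image_orbit, orthSets_orbit_iff]

theorem isSemiAutomorphism_iff {k : ℕ∞} :
    IsSemiAutomorphism k Φ ↔ IsDiffeo k Φ ∧ CommutesWithPhase Φ ∧
      ∀ φ ψ : State H, inner ℂ (φ : H) (ψ : H) = 0 → inner ℂ (Φ φ : H) (Φ ψ : H) = 0 :=
  ⟨fun h => ⟨h.diffeo, h.commutes, fun φ ψ hφψ =>
      h.commutes.orthSets_image_orbit_iff.1 (h.orthogonality φ ψ (orthSets_orbit_iff.2 hφψ))⟩,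
    fun ⟨hΦ, hcomm, horth⟩ => ⟨hΦ, hcomm, fun φ ψ hφψ =>
      hcomm.orthSets_image_orbit_iff.2 (horth φ ψ (orthSets_orbit_iff.1 hφψ))⟩⟩

end Phase

section IsCk

variable {H F G : Type*} [NormedAddCommGroup H] [InnerProductSpace ℂ H]
  [NormedAddCommGroup F] [NormedSpace ℝ F] [NormedAddCommGroup G] [NormedSpace ℝ G] {k : ℕ∞}

theorem isCk_of_contDiff {g : H → F} (hg : ContDiff ℝ k g) : IsCk k (fun φ : State H => g φ) :=
  fun _ => ⟨Set.univ, isOpen_univ, trivial, g, hg.contDiffOn, fun _ _ => rfl⟩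

theorem IsCk.continuous {f : State H → F} (hf : IsCk k f) : Continuous f := by
  refine continuous_iff_continuousAt.2 fun φ => ?_
  obtain ⟨W, hW, hφ, g, hg, hgf⟩ := hf φ
  have hgφ : ContinuousAt (fun ψ : State H => g ψ) φ :=
    (hg.continuousOn.continuousAt (hW.mem_nhds hφ)).comp continuousAt_subtype_val
  refine hgφ.congr ?_
  filter_upwards [continuousAt_subtype_val.preimage_mem_nhds (hW.mem_nhds hφ)] with ψ hψ
  exact hgf ψ hψ

theorem IsCk.of_eventually_comp {f : State H → F} (hf : IsCk k f) {h : State H → G}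
    (hh : ∀ φ : State H, ∃ (g : F → G) (V : Set F), IsOpen V ∧ f φ ∈ V ∧ ContDiffOn ℝ k g V ∧
      ∀ᶠ ψ in nhds φ, h ψ = g (f ψ)) : IsCk k h := fun φ => by
  obtain ⟨W, hW, hφ, f', hf', hff'⟩ := hf φ
  obtain ⟨g, V, hV, hfV, hg, hev⟩ := hh φ
  obtain ⟨A, hA, hAh⟩ := (mem_nhds_induced _ _ _).1 hev
  obtain ⟨A', hA'A, hA'o, hφA'⟩ := mem_nhds_iff.1 hA
  refine ⟨(W ∩ f' ⁻¹' V) ∩ A', (hf'.continuousOn.isOpen_inter_preimage hW hV).inter hA'o,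
    ⟨⟨hφ, Set.mem_preimage.2 (hff' φ hφ ▸ hfV)⟩, hφA'⟩, g ∘ f',
    hg.comp (hf'.mono fun x hx => hx.1.1) fun x hx => hx.1.2, fun ψ hψ => ?_⟩
  rw [Function.comp_apply, hff' ψ hψ.1.1]
  exact (hAh (hA'A hψ.2)).symm

theorem IsCk.contDiff_comp {g : F → G} (hg : ContDiff ℝ k g) {f : State H → F}
    (hf : IsCk k f) : IsCk k (fun φ => g (f φ)) :=
  hf.of_eventually_comp fun _ =>
    ⟨g, Set.univ, isOpen_univ, trivial, hg.contDiffOn, Filter.Eventually.of_forall fun _ => rfl⟩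

theorem IsCk.comp {f : State H → F} (hf : IsCk k f) {Φ : State H → State H}
    (hΦ : IsCk k (fun φ => (Φ φ : H))) : IsCk k (fun φ => f (Φ φ)) :=
  hΦ.of_eventually_comp fun φ => by
    obtain ⟨W, hW, hφ, g, hg, hgf⟩ := hf (Φ φ)
    refine ⟨g, W, hW, hφ, hg, ?_⟩
    filter_upwards [hΦ.continuous.continuousAt.preimage_mem_nhds (hW.mem_nhds hφ)] with ψ hψ
    exact (hgf _ hψ).symm

theorem IsCk.prodMk {f : State H → F} {g : State H → G} (hf : IsCk k f) (hg : IsCk k g) :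
    IsCk k (fun φ => (f φ, g φ)) := fun φ => by
  obtain ⟨W, hW, hφ, f', hf', hff'⟩ := hf φ
  obtain ⟨W', hW', hφ', g', hg', hgg'⟩ := hg φ
  exact ⟨W ∩ W', hW.inter hW', ⟨hφ, hφ'⟩, fun x => (f' x, g' x),
    (hf'.mono Set.inter_subset_left).prodMk (hg'.mono Set.inter_subset_right),
    fun ψ hψ => Prod.ext (hff' ψ hψ.1) (hgg' ψ hψ.2)⟩

theorem IsDiffeo.mul {Φ Ψ : Equiv.Perm (State H)} (hΦ : IsDiffeo k Φ) (hΨ : IsDiffeo k Ψ) :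
    IsDiffeo k (Φ * Ψ) :=
  ⟨hΦ.1.comp hΨ.1, hΨ.2.comp hΦ.2⟩

end IsCk

section RadialExtension

section Real

variable {E : Type*} [NormedAddCommGroup E] [NormedSpace ℝ E] {f : State E → State E}

/-- The radial projection of `E \ {0}` onto the state space. -/
def normalize (v : E) (hv : v ≠ 0) : State E :=
  ⟨(√2 / ‖v‖) • v, by
    rw [mem_sphere_zero_iff_norm, norm_smul, norm_div, norm_norm, Real.norm_of_nonneg (by simp),
      div_mul_cancel₀ _ (norm_ne_zero_iff.2 hv)]⟩

theorem coe_normalize (v : E) (hv : v ≠ 0) : (normalize v hv : E) = (√2 / ‖v‖) • v := rfl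

theorem normalize_coe (φ : State E) : normalize (φ : E) φ.coe_ne_zero = φ := by
  ext
  rw [coe_normalize, φ.norm_eq, div_self (by simp), one_smul]

open Classical in
/-- The extension of a transformation of the state space to the whole space that is positively
homogeneous of degree one. -/
def radialExt (f : State E → State E) (v : E) : E :=
  if hv : v = 0 then 0 else (‖v‖ / √2) • (f (normalize v hv) : E)

theorem radialExt_of_ne {v : E} (hv : v ≠ 0) :
    radialExt f v = (‖v‖ / √2) • (f (normalize v hv) : E) := dif_neg hv

@[simp] theorem radialExt_zero : radialExt f 0 = 0 := dif_pos rfl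

@[simp] theorem radialExt_coe (φ : State E) : radialExt f φ = f φ := by
  rw [radialExt_of_ne φ.coe_ne_zero, normalize_coe, φ.norm_eq, div_self (by simp), one_smul]

@[simp] theorem norm_radialExt (v : E) : ‖radialExt f v‖ = ‖v‖ := by
  obtain rfl | hv := eq_or_ne v 0
  · simp
  · rw [radialExt_of_ne hv, norm_smul, State.norm_eq, norm_div, norm_norm,
      Real.norm_of_nonneg (by simp), div_mul_cancel₀ _ (by simp)]

theorem radialExt_eq_zero_iff {v : E} : radialExt f v = 0 ↔ v = 0 := by
  rw [← norm_eq_zero, norm_radialExt, norm_eq_zero]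

theorem normalize_radialExt {v : E} (hv : v ≠ 0) (h : radialExt f v ≠ 0) :
    normalize (radialExt f v) h = f (normalize v hv) := by
  have := norm_ne_zero_iff.2 hv
  ext
  rw [coe_normalize, norm_radialExt, radialExt_of_ne hv, smul_smul]
  convert one_smul ℝ _
  field_simp

theorem radialExt_leftInverse {g : State E → State E} (h : Function.LeftInverse g f) :
    Function.LeftInverse (radialExt g) (radialExt f) := fun v => by
  obtain rfl | hv := eq_or_ne v 0
  · simp
  · have hfv : radialExt f v ≠ 0 := radialExt_eq_zero_iff.not.2 hv
    have := norm_ne_zero_iff.2 hv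
    rw [radialExt_of_ne hfv, normalize_radialExt hv, h, norm_radialExt, coe_normalize, smul_smul]
    convert one_smul ℝ _
    field_simp

/-- The radial extension of a bijection of the state space, as a bijection of the whole space. -/
def radialPerm (Φ : Equiv.Perm (State E)) : Equiv.Perm E where
  toFun := radialExt Φ
  invFun := radialExt Φ.symm
  left_inv := radialExt_leftInverse Φ.left_inv
  right_inv := radialExt_leftInverse Φ.right_inv

end Real

variable {H : Type*} [NormedAddCommGroup H] [InnerProductSpace ℂ H]

theorem inner_normalize_eq_zero_iff {v w : H} (hv : v ≠ 0) (hw : w ≠ 0) :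
    inner ℂ (normalize v hv : H) (normalize w hw : H) = 0 ↔ inner ℂ v w = 0 := by
  rw [coe_normalize, coe_normalize, inner_smul_left_eq_smul, inner_smul_right_eq_smul]
  simp [hv, hw]

theorem radialExt_smul {Φ : Equiv.Perm (State H)} (hΦ : CommutesWithPhase Φ) (c : ℂ) (v : H) :
    radialExt Φ (c • v) = c • radialExt Φ v := by
  obtain rfl | hc := eq_or_ne c 0
  · simp
  obtain rfl | hv := eq_or_ne v 0
  · simp
  have hcv : c • v ≠ 0 := smul_ne_zero hc hv
  have hc' : (‖c‖ : ℂ) ≠ 0 := by exact_mod_cast norm_ne_zero_iff.2 hc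
  have := norm_ne_zero_iff.2 hv
  have map_normalize : (Φ (normalize (c • v) hcv) : H) = (c / ‖c‖) • (Φ (normalize v hv) : H) := by
    refine hΦ.map_smul (by simp [hc]) ?_
    simp only [coe_normalize, norm_smul, ← Complex.coe_smul, smul_smul]
    congr 1
    push_cast
    field_simp
  simp only [radialExt_of_ne hcv, radialExt_of_ne hv, map_normalize, norm_smul,
    ← Complex.coe_smul, smul_smul]
  congr 1
  push_cast
  field_simp

theorem inner_radialExt_eq_zero {f : State H → State H}
    (hf : ∀ φ ψ : State H, inner ℂ (φ : H) (ψ : H) = 0 → inner ℂ (f φ : H) (f ψ : H) = 0)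
    {v w : H} (h : inner ℂ v w = 0) : inner ℂ (radialExt f v) (radialExt f w) = 0 := by
  obtain rfl | hv := eq_or_ne v 0
  · simp
  obtain rfl | hw := eq_or_ne w 0
  · simp
  rw [← inner_normalize_eq_zero_iff (radialExt_eq_zero_iff.not.2 hv)
    (radialExt_eq_zero_iff.not.2 hw), normalize_radialExt hv, normalize_radialExt hw]
  exact hf _ _ ((inner_normalize_eq_zero_iff hv hw).2 h)

theorem contDiffOn_radial (k : ℕ∞) :
    ContDiffOn ℝ k (fun v : H => (√2 / ‖v‖) • v) {0}ᶜ := by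
  let _ : InnerProductSpace ℝ H := InnerProductSpace.rclikeToReal ℂ H
  exact (contDiffOn_const.div (contDiffOn_id.norm ℝ fun _ hv => hv)
    fun v (hv : v ≠ 0) => norm_ne_zero_iff.2 hv).smul contDiffOn_id

theorem contDiffOn_radialExt {k : ℕ∞} {f : State H → State H}
    (hf : IsCk k (fun φ => (f φ : H))) : ContDiffOn ℝ k (radialExt f) {0}ᶜ := by
  let _ : InnerProductSpace ℝ H := InnerProductSpace.rclikeToReal ℂ H
  intro v hv
  obtain ⟨W, hW, hφ, g, hg, hgf⟩ := hf (normalize v hv)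
  set O := ({0}ᶜ : Set H) ∩ (fun v : H => (√2 / ‖v‖) • v) ⁻¹' W
  have hO : O ∈ nhds v := ((contDiffOn_radial 0).continuousOn.isOpen_inter_preimage
    isOpen_compl_singleton hW).mem_nhds ⟨hv, hφ⟩
  have hgO : ContDiffOn ℝ k (fun v : H => (‖v‖ / √2) • g ((√2 / ‖v‖) • v)) O :=
    ((contDiffOn_id.norm ℝ fun v hv => hv.1).div_const _).smul
      (hg.comp ((contDiffOn_radial k).mono Set.inter_subset_left) fun v hv => hv.2)
  refine ((hgO.contDiffAt hO).congr_of_eventuallyEq ?_).contDiffWithinAt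
  filter_upwards [hO] with w hw
  rw [radialExt_of_ne hw.1]
  exact congrArg _ (hgf (normalize w hw.1) hw.2).symm

end RadialExtension

section InverseOrthogonality

variable {H H' : Type*} [NormedAddCommGroup H] [InnerProductSpace ℂ H]
  [NormedAddCommGroup H'] [InnerProductSpace ℂ H']

theorem exists_ne_zero_inner_eq_zero (hH : 1 < Module.rank ℂ H) (x : H) :
    ∃ z : H, inner ℂ x z = 0 ∧ z ≠ 0 := by
  have hx : (ℂ ∙ x)ᗮ ≠ ⊥ := fun h => by
    rw [Submodule.orthogonal_eq_bot_iff] at h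
    have hle := (rank_span_le (R := ℂ) {x}).trans (Cardinal.mk_singleton x).le
    rw [h, rank_top] at hle
    exact hle.not_gt hH
  obtain ⟨z, hz, hz0⟩ := Submodule.exists_mem_ne_zero_of_ne_bot hx
  exact ⟨z, Submodule.mem_orthogonal_singleton_iff_inner_right.1 hz, hz0⟩

theorem one_lt_rank_real_of_nontrivial {E : Type*} [AddCommGroup E] [Module ℂ E] [Nontrivial E] :
    1 < Module.rank ℝ E := by
  rw [rank_real_of_complex]
  exact Cardinal.one_lt_two.trans_le
    (le_mul_of_one_le_right' (Cardinal.one_le_iff_pos.2 rank_pos))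

theorem inner_eq_zero_of_map_inner_eq_zero {D : H →ₗ[ℝ] H'} (hD : Function.Surjective D) {x : H}
    {y : H'} (hx : x ≠ 0) (hy : y ≠ 0) (h : ∀ v, inner ℂ x v = 0 → inner ℂ y (D v) = 0) {v : H}
    (hv : inner ℂ y (D v) = 0) : inner ℂ x v = 0 := by
  have hxx : inner ℂ x x ≠ 0 := inner_self_ne_zero.2 hx
  let L : H →ₗ[ℝ] ℂ := (innerₛₗ ℂ y).restrictScalars ℝ ∘ₗ D
  let A : ℂ →ₗ[ℝ] ℂ := L ∘ₗ (LinearMap.toSpanSingleton ℂ H x).restrictScalars ℝ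
  have L_eq : ∀ w, L w = A (inner ℂ x w / inner ℂ x x) := fun w => by
    have hw : inner ℂ x (w - (inner ℂ x w / inner ℂ x x) • x) = 0 := by
      rw [inner_sub_right, inner_smul_right, div_mul_cancel₀ _ hxx, sub_self]
    exact sub_eq_zero.1 ((map_sub L _ _).symm.trans (h _ hw))
  have A_surjective : Function.Surjective A := fun c => by
    obtain ⟨w, hw⟩ := hD ((c / inner ℂ y y) • y)
    refine ⟨inner ℂ x w / inner ℂ x x, (L_eq w).symm.trans ?_⟩
    change inner ℂ y (D w) = c
    rw [hw, inner_smul_right, div_mul_cancel₀ _ (inner_self_ne_zero.2 hy)]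
  have A_injective : Function.Injective A := LinearMap.injective_iff_surjective.2 A_surjective
  have hAv : A (inner ℂ x v / inner ℂ x x) = A 0 := by
    rw [← L_eq, map_zero]
    exact hv
  exact (div_eq_zero_iff.1 (A_injective hAv)).resolve_right hxx

theorem inner_fderiv_eq_zero {F : H → H'} {F' : H →L[ℝ] H'} {x v : H} {y : H'}
    (hF : HasFDerivAt F F' v) (h : ∀ u, inner ℂ x u = 0 → inner ℂ y (F u) = 0)
    (hv : inner ℂ x v = 0) {w : H} (hw : inner ℂ x w = 0) : inner ℂ y (F' w) = 0 := by
  let L : H' →L[ℝ] ℂ := (innerSL ℂ y).restrictScalars ℝ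
  have hline : HasDerivAt (fun t : ℝ => L (F (v + t • w))) (L (F' w)) 0 :=
    (L.hasFDerivAt.comp v hF).hasLineDerivAt w
  have hzero : (fun t : ℝ => L (F (v + t • w))) = fun _ => 0 := funext fun t =>
    h _ (by rw [inner_add_right, inner_smul_right_eq_smul, hv, hw, smul_zero, add_zero])
  rw [hzero] at hline
  exact hline.unique (hasDerivAt_const 0 0)

theorem exists_hasStrictFDerivAt_surjective {E E' : Type*} [NormedAddCommGroup E]
    [NormedSpace ℝ E] [NormedAddCommGroup E'] [NormedSpace ℝ E'] {F : E ≃ E'} {v : E}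
    (hF : ContDiffAt ℝ 1 F v) (hG : ContDiffAt ℝ 1 F.symm (F v)) :
    ∃ F' : E →L[ℝ] E', HasStrictFDerivAt F F' v ∧ Function.Surjective F' := by
  have hFv := hF.hasStrictFDerivAt one_ne_zero
  refine ⟨_, hFv, fun w => ⟨fderiv ℝ F.symm (F v) w, ?_⟩⟩
  have hFGv : HasFDerivAt F (fderiv ℝ F v) (F.symm (F v)) := by
    rw [F.symm_apply_apply]
    exact hFv.hasFDerivAt
  have hcomp := hFGv.comp (F v) (hG.differentiableAt one_ne_zero).hasFDerivAt
  rw [F.self_comp_symm] at hcomp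
  exact DFunLike.congr_fun (hcomp.unique (hasFDerivAt_id _)) w

theorem map_nhds_orthogonal_eq [CompleteSpace H] [CompleteSpace H'] {F : H → H'} {x : H} {y : H'}
    (hx : x ≠ 0) (hy : y ≠ 0) {f : (ℂ ∙ x)ᗮ → (ℂ ∙ y)ᗮ} (hf : ∀ u, (f u : H') = F u)
    {v : (ℂ ∙ x)ᗮ} {F' : H →L[ℝ] H'} (hF : HasStrictFDerivAt F F' (v : H))
    (hF' : Function.Surjective F') : Filter.map f (nhds v) = nhds (f v) := by
  have mem_iff : ∀ {z u : H}, u ∈ (ℂ ∙ z)ᗮ ↔ inner ℂ z u = 0 :=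
    Submodule.mem_orthogonal_singleton_iff_inner_right
  have mem_iff' : ∀ {z u : H'}, u ∈ (ℂ ∙ z)ᗮ ↔ inner ℂ z u = 0 :=
    Submodule.mem_orthogonal_singleton_iff_inner_right
  have F_orth : ∀ u, inner ℂ x u = 0 → inner ℂ y (F u) = 0 := fun u hu =>
    mem_iff'.1 (hf ⟨u, mem_iff.2 hu⟩ ▸ (f ⟨u, mem_iff.2 hu⟩).2)
  have F'_orth : ∀ w, inner ℂ x w = 0 → inner ℂ y (F' w) = 0 := fun w hw =>
    inner_fderiv_eq_zero hF.hasFDerivAt F_orth (mem_iff.1 v.2) hw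
  let i : (ℂ ∙ x)ᗮ →L[ℝ] H := (ℂ ∙ x)ᗮ.subtypeL.restrictScalars ℝ
  let P : H' →L[ℝ] (ℂ ∙ y)ᗮ := (ℂ ∙ y)ᗮ.orthogonalProjectionOnto.restrictScalars ℝ
  have hP : ∀ u : (ℂ ∙ y)ᗮ, P u = u := (ℂ ∙ y)ᗮ.orthogonalProjectionOnto_mem_subspace_eq_self
  have hFi : HasStrictFDerivAt (fun u : (ℂ ∙ x)ᗮ => F u) (F'.comp i) v :=
    HasStrictFDerivAt.comp v (g := F) (f := fun u : (ℂ ∙ x)ᗮ => (u : H)) hF i.hasStrictFDerivAt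
  have hf' : HasStrictFDerivAt f (P.comp (F'.comp i)) v := by
    have hfP : f = fun u : (ℂ ∙ x)ᗮ => P (F u) := funext fun u => by rw [← hf, hP]
    rw [hfP]
    exact P.hasStrictFDerivAt.comp v hFi
  refine hf'.map_nhds_eq_of_surj (LinearMap.range_eq_top.2 fun w => ?_)
  obtain ⟨u, hu⟩ := hF' w
  have hxu : inner ℂ x u = 0 := inner_eq_zero_of_map_inner_eq_zero (D := F'.toLinearMap) hF' hx hy
    F'_orth (by rw [ContinuousLinearMap.coe_coe, hu]; exact mem_iff'.1 w.2)
  exact ⟨⟨u, mem_iff.2 hxu⟩, (congrArg P hu).trans (hP w)⟩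

theorem forall_eq_of_isPreconnected {X Y : Type*} [TopologicalSpace X] [TopologicalSpace Y]
    [T1Space Y] {S : Set X} (hS : IsPreconnected S) (hSo : IsOpen S) {g : X → Y}
    (hg : ContinuousOn g S) {c : Y} (hloc : ∀ u ∈ S, g u = c → ∀ᶠ v in nhds u, g v = c)
    (hne : ∃ u ∈ S, g u = c) : ∀ u ∈ S, g u = c := by
  have h_eq : IsOpen (S ∩ {u | g u = c}) := isOpen_iff_mem_nhds.2 fun u hu =>
    Filter.inter_mem (hSo.mem_nhds hu.1) (hloc u hu.1 hu.2)
  have h_ne : IsOpen (S ∩ {u | g u ≠ c}) := hg.isOpen_inter_preimage hSo isOpen_compl_singleton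
  obtain ⟨u₀, hu₀, hgu₀⟩ := hne
  exact fun u hu => (hS.subset_left_of_subset_union h_eq h_ne
    (Set.disjoint_left.2 fun _ hv hv' => hv'.2 hv.2)
    (fun v hv => (em (g v = c)).imp (And.intro hv) (And.intro hv)) ⟨u₀, hu₀, hu₀, hgu₀⟩ hu).2

theorem inner_eq_zero_of_inner_map_eq_zero [CompleteSpace H] (hH : 1 < Module.rank ℂ H)
    {F : Equiv.Perm H} (F_zero : F 0 = 0) (hF : ContDiffOn ℝ 1 F {0}ᶜ)
    (hG : ContDiffOn ℝ 1 F.symm {0}ᶜ)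
    (horth : ∀ x w, inner ℂ x w = 0 → inner ℂ (F x) (F w) = 0) {x w : H} (hx : x ≠ 0)
    (h : inner ℂ (F x) (F w) = 0) : inner ℂ x w = 0 := by
  have mem_iff : ∀ {z u : H}, u ∈ (ℂ ∙ z)ᗮ ↔ inner ℂ z u = 0 :=
    Submodule.mem_orthogonal_singleton_iff_inner_right
  have F_ne : ∀ {v}, F v ≠ 0 ↔ v ≠ 0 := fun {v} => by
    rw [Ne, Ne, ← F.apply_eq_iff_eq (x := v), F_zero]
  have G_ne : ∀ {u : (ℂ ∙ F x)ᗮ}, u ≠ 0 → F.symm u ≠ 0 := fun {u} hu => by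
    rw [← F_ne, F.apply_symm_apply]
    exact fun h0 => hu (Subtype.ext h0)
  let f : (ℂ ∙ x)ᗮ → (ℂ ∙ F x)ᗮ := fun v => ⟨F v, mem_iff.2 (horth _ _ (mem_iff.1 v.2))⟩
  obtain ⟨z, hxz, hz⟩ := exists_ne_zero_inner_eq_zero hH x
  have hfz : f ⟨z, mem_iff.2 hxz⟩ ≠ 0 := fun h0 => F_ne.2 hz (congrArg Subtype.val h0)
  have : Nontrivial (ℂ ∙ F x)ᗮ := ⟨_, 0, hfz⟩
  -- The nonzero vectors of `(F x)ᗮ` form a connected set, on which being the image of a vector of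
  -- `xᗮ` is an open and closed condition.
  have key : ∀ u ∈ ({0}ᶜ : Set (ℂ ∙ F x)ᗮ), inner ℂ x (F.symm u) = 0 := by
    refine forall_eq_of_isPreconnected
      (isConnected_compl_singleton_of_one_lt_rank one_lt_rank_real_of_nontrivial 0).isPreconnected
      isOpen_compl_singleton (continuousOn_const.inner (𝕜 := ℂ) (hG.continuousOn.comp
        continuous_subtype_val.continuousOn fun _ hu => Submodule.coe_eq_zero.not.2 hu))
      (fun u hu0 hu => ?_)
      ⟨_, hfz, (congrArg (inner ℂ x) (F.symm_apply_apply z)).trans hxz⟩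
    obtain ⟨F', hF', hsurj⟩ := exists_hasStrictFDerivAt_surjective
      (hF.contDiffAt (isOpen_compl_singleton.mem_nhds (G_ne hu0)))
      (hG.contDiffAt (isOpen_compl_singleton.mem_nhds (F_ne.2 (G_ne hu0))))
    have hfu : f ⟨F.symm u, mem_iff.2 hu⟩ = u := Subtype.ext (F.apply_symm_apply _)
    rw [← hfu, ← map_nhds_orthogonal_eq (f := f) (v := ⟨F.symm u, mem_iff.2 hu⟩) hx (F_ne.2 hx)
      (fun _ => rfl) hF' hsurj, Filter.eventually_map]
    exact Filter.Eventually.of_forall fun v => (congrArg (inner ℂ x)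
      (F.symm_apply_apply v)).trans (mem_iff.1 v.2)
  obtain rfl | hw := eq_or_ne w 0
  · exact inner_zero_right x
  have hFw := key ⟨F w, mem_iff.2 h⟩ fun h0 => F_ne.2 hw (congrArg Subtype.val h0)
  rwa [F.symm_apply_apply] at hFw

end InverseOrthogonality

section Uhlhorn

variable {H H' : Type*} [NormedAddCommGroup H] [InnerProductSpace ℂ H]
  [NormedAddCommGroup H'] [InnerProductSpace ℂ H']

theorem map_add_of_map_add_of_linearIndependent {K V W : Type*} [Field K] [AddCommGroup V]
    [Module K V] [AddCommGroup W] (hV : 1 < Module.rank K V) {f : V → W} (f_zero : f 0 = 0)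
    (hf : ∀ x y, LinearIndependent K ![x, y] → f (x + y) = f x + f y) (x y : V) :
    f (x + y) = f x + f y := by
  obtain rfl | hx := eq_or_ne x 0
  · rw [zero_add, f_zero, zero_add]
  by_cases hxy : LinearIndependent K ![x, y]
  · exact hf x y hxy
  rw [LinearIndependent.pair_iff' hx] at hxy
  push Not at hxy
  obtain ⟨c, rfl⟩ := hxy
  obtain ⟨z, hxz⟩ := exists_linearIndependent_pair_of_one_lt_rank hV hx
  have f_smul_add : ∀ d : K, f (d • x + z) = f (d • x) + f z := fun d => by
    obtain rfl | hd := eq_or_ne d 0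
    · rw [zero_smul, zero_add, f_zero, zero_add]
    · refine hf _ _ ((LinearIndependent.pair_iff' (smul_ne_zero hd hx)).2 fun a => ?_)
      rw [smul_smul]
      exact (LinearIndependent.pair_iff' hx).1 hxz _
  have f_add : f (x + (c • x + z)) = f x + f (c • x + z) := by
    refine hf _ _ ((LinearIndependent.pair_iff' hx).2 fun a ha => ?_)
    refine (LinearIndependent.pair_iff' hx).1 hxz (a - c) ?_
    rw [sub_smul, ha, add_sub_cancel_left]
  refine add_right_cancel (b := f z) ?_
  calc f (x + c • x) + f z = f ((1 + c) • x) + f z := by rw [add_smul, one_smul]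
    _ = f ((1 + c) • x + z) := (f_smul_add _).symm
    _ = f (x + (c • x + z)) := by rw [add_smul, one_smul, add_assoc]
    _ = f x + f (c • x) + f z := by rw [f_add, f_smul_add, add_assoc]

theorem one_lt_rank_orthogonal_singleton (hH : 2 < Module.rank ℂ H) (e : H) :
    1 < Module.rank ℂ (ℂ ∙ e)ᗮ := by
  by_contra! h
  have hle := Submodule.rank_add_le_rank_add_rank (ℂ ∙ e) (ℂ ∙ e)ᗮ
  rw [Submodule.sup_orthogonal_of_hasOrthogonalProjection, rank_top] at hle
  have he : Module.rank ℂ (ℂ ∙ e) ≤ 1 :=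
    (rank_span_le (R := ℂ) {e}).trans (Cardinal.mk_singleton e).le
  exact (hle.trans (add_le_add he h)).not_gt (by rwa [one_add_one_eq_two])

theorem eq_or_eq_of_forall_eq_or_eq {A B : Type*} [AddGroup A] [AddGroup B] {f g h : A →+ B}
    (H : ∀ x, f x = g x ∨ f x = h x) : f = g ∨ f = h := by
  have hcover : ((⊤ : AddSubgroup A) : Set A) ⊆ f.eqLocus g ∪ f.eqLocus h := fun x _ => H x
  exact (AddSubgroupClass.subset_union.1 hcover).imp
    (fun hle => AddMonoidHom.ext fun x => hle (AddSubgroup.mem_top x))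
    fun hle => AddMonoidHom.ext fun x => hle (AddSubgroup.mem_top x)

theorem eq_I_or_eq_neg_I {τ : ℂ} (h : ‖τ‖ = 1) (h' : ‖1 + τ‖ = ‖1 + Complex.I‖) :
    τ = Complex.I ∨ τ = -Complex.I := by
  have hτ : τ.re * τ.re + τ.im * τ.im = 1 := by
    rw [← Complex.normSq_apply, Complex.normSq_eq_norm_sq, h, one_pow]
  have hτ' : (1 + τ.re) * (1 + τ.re) + τ.im * τ.im = 2 := by
    have := congrArg (· ^ 2) h'
    simp only [← Complex.normSq_eq_norm_sq, Complex.normSq_apply] at this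
    norm_num at this
    linarith
  have hre : τ.re = 0 := by linarith
  have him : τ.im = 1 ∨ τ.im = -1 := mul_self_eq_one_iff.1 (by simpa [hre] using hτ)
  exact him.imp (fun h => Complex.ext (by simpa) (by simpa))
    fun h => Complex.ext (by simpa) (by simpa)

theorem norm_map_of_inner_eq_neg_one {E E' : Type*} [NormedAddCommGroup E]
    [InnerProductSpace ℂ E] [NormedAddCommGroup E'] [InnerProductSpace ℂ E'] (B : E →ₗ[ℝ] E')
    (hB : ∀ x y, inner ℂ x y = -1 → inner ℂ (B x) (B y) = -1) (x : E) : ‖B x‖ = ‖x‖ := by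
  obtain rfl | hx := eq_or_ne x 0
  · simp
  have hx' : (‖x‖ : ℂ) ≠ 0 := by simpa
  have h := hB x ((-(‖x‖ ^ 2)⁻¹ : ℝ) • x) (by
    rw [inner_smul_right_eq_smul, inner_self_eq_norm_sq_to_K, Complex.real_smul]
    push_cast
    rw [neg_mul, neg_inj]
    exact inv_mul_cancel₀ (pow_ne_zero 2 hx'))
  rw [map_smul, inner_smul_right_eq_smul, inner_self_eq_norm_sq_to_K, Complex.real_smul] at h
  have hsq : (‖B x‖ : ℂ) ^ 2 = (‖x‖ : ℂ) ^ 2 := by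
    push_cast at h
    rw [neg_mul, neg_inj, inv_mul_eq_one₀ (pow_ne_zero 2 hx')] at h
    exact h.symm
  exact (sq_eq_sq₀ (norm_nonneg _) (norm_nonneg _)).1 (by exact_mod_cast hsq)

theorem map_smul_of_map_smul_I {E E' : Type*} [AddCommGroup E] [Module ℂ E] [AddCommGroup E']
    [Module ℂ E'] (B : E →ₗ[ℝ] E') {σ : ℂ →+* ℂ} (hσ : ∀ r : ℝ, σ r = r)
    (hI : ∀ x, B (Complex.I • x) = σ Complex.I • B x) (c : ℂ) (x : E) :
    B (c • x) = σ c • B x := by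
  rw [← Complex.re_add_im c, add_smul, mul_smul, Complex.coe_smul, Complex.coe_smul, map_add,
    map_smul, map_smul, hI, map_add, map_mul, hσ, hσ, add_smul, mul_smul, Complex.coe_smul,
    Complex.coe_smul]

theorem exists_linearIsometry_extend {σ : ℂ →+* ℂ} [RingHomIsometric σ] {e : H} (he : ‖e‖ = 1)
    {f : H'} (hf : ‖f‖ = 1) (B : (ℂ ∙ e)ᗮ →ₛₗᵢ[σ] H') (hB : ∀ x, inner ℂ f (B x) = 0) :
    ∃ V : H →ₛₗᵢ[σ] H', V e = f ∧ ∀ x : (ℂ ∙ e)ᗮ, V x = B x := by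
  have inner_e : ∀ x : (ℂ ∙ e)ᗮ, inner ℂ e (x : H) = 0 := fun x =>
    Submodule.mem_orthogonal_singleton_iff_inner_right.1 x.2
  have inner_ee : inner ℂ e e = 1 := by simp [inner_self_eq_norm_sq_to_K, he]
  let P := (ℂ ∙ e)ᗮ.orthogonalProjectionOnto
  let V : H →ₛₗ[σ] H' :=
    { toFun := fun v => σ (inner ℂ e v) • f + B (P v)
      map_add' := fun v w => by
        rw [inner_add_right, map_add, map_add, map_add, add_smul]
        abel
      map_smul' := fun c v => by
        rw [inner_smul_right, map_mul, map_smul, map_smulₛₗ, mul_smul, smul_add] }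
  have decomp : ∀ v : H, inner ℂ e v • e + (P v : H) = v := fun v => by
    have h := (ℂ ∙ e).starProjection_add_starProjection_orthogonal v
    rwa [Submodule.starProjection_unit_singleton ℂ he] at h
  have norm_V : ∀ v, ‖V v‖ = ‖v‖ := fun v => by
    have orth : inner ℂ (inner ℂ e v • e) (P v : H) = 0 := by
      rw [inner_smul_left, inner_e, mul_zero]
    have orth' : inner ℂ (σ (inner ℂ e v) • f) (B (P v)) = 0 := by
      rw [inner_smul_left, hB, mul_zero]
    have h := norm_add_sq_eq_norm_sq_add_norm_sq_of_inner_eq_zero _ _ orth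
    have h' := norm_add_sq_eq_norm_sq_add_norm_sq_of_inner_eq_zero _ _ orth'
    rw [decomp, norm_smul, he] at h
    rw [norm_smul, RingHomIsometric.norm_map, hf, B.norm_map, Submodule.coe_norm, ← h] at h'
    exact (mul_self_inj (norm_nonneg _) (norm_nonneg _)).1 h'
  refine ⟨⟨V, norm_V⟩, ?_, fun x => ?_⟩
  · change σ (inner ℂ e e) • f + B (P e) = f
    rw [inner_ee, map_one, one_smul, (ℂ ∙ e).orthogonalProjectionOnto_orthogonal_apply_eq_zero
      (Submodule.mem_span_singleton_self e), map_zero, add_zero]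
  · change σ (inner ℂ e (x : H)) • f + B (P x) = B x
    rw [inner_e, map_zero, zero_smul, zero_add,
      (ℂ ∙ e)ᗮ.orthogonalProjectionOnto_mem_subspace_eq_self]

/-- The homogeneous maps of Uhlhorn's theorem: norm-preserving surjections, continuous off the
origin, that preserve and reflect orthogonality. They are not assumed to be additive. -/
structure IsOrthoMap (F : H → H') : Prop where
  continuousOn : ContinuousOn F {0}ᶜ
  map_smul : ∀ (c : ℂ) (v : H), F (c • v) = c • F v
  norm_map : ∀ v, ‖F v‖ = ‖v‖
  inner_eq_zero_iff : ∀ v w, inner ℂ (F v) (F w) = 0 ↔ inner ℂ v w = 0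
  surjective : Function.Surjective F

/-- The expression of `F` in the affine charts `x ↦ e + x` of the projective spaces, where `x`
is orthogonal to `e` at the source and to `F e` at the target. -/
def chart (F : H → H') (e : H) (x : (ℂ ∙ e)ᗮ) : H' :=
  (inner ℂ (F e) (F (e + x)))⁻¹ • F (e + x) - F e

namespace IsOrthoMap

variable {F : H → H'} {e : H}

theorem map_eq_zero_iff (hF : IsOrthoMap F) {v : H} : F v = 0 ↔ v = 0 := by
  rw [← norm_eq_zero, hF.norm_map, norm_eq_zero]

theorem exists_map_lincomb (hF : IsOrthoMap F) (x y : H) (s t : ℂ) :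
    ∃ a b : ℂ, F (s • x + t • y) = a • F x + b • F y := by
  have : FiniteDimensional ℂ (Submodule.span ℂ {F x, F y}) :=
    FiniteDimensional.span_of_finite ℂ (Set.toFinite _)
  have h : F (s • x + t • y) ∈ (Submodule.span ℂ {F x, F y})ᗮᗮ := by
    rw [Submodule.mem_orthogonal]
    intro u hu
    obtain ⟨w, rfl⟩ := hF.surjective u
    rw [Submodule.mem_orthogonal'] at hu
    have hwx := (hF.inner_eq_zero_iff _ _).1 (hu (F x) (Submodule.subset_span (by simp)))
    have hwy := (hF.inner_eq_zero_iff _ _).1 (hu (F y) (Submodule.subset_span (by simp)))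
    rw [hF.inner_eq_zero_iff, inner_add_right, inner_smul_right, inner_smul_right, hwx, hwy,
      mul_zero, mul_zero, add_zero]
  rw [Submodule.orthogonal_orthogonal, Submodule.mem_span_pair] at h
  obtain ⟨a, b, hab⟩ := h
  exact ⟨a, b, hab.symm⟩

theorem exists_eq_smul (hF : IsOrthoMap F) {x y : H} (hx : x ≠ 0) {c : ℂ} (h : F y = c • F x) :
    ∃ c : ℂ, y = c • x := by
  set d := inner ℂ x y / inner ℂ x x with hd
  have inner_x : inner ℂ (y - d • x) x = 0 := by
    rw [inner_eq_zero_symm, inner_sub_right, inner_smul_right, hd,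
      div_mul_cancel₀ _ (inner_self_ne_zero.2 hx), sub_self]
  have inner_y : inner ℂ (y - d • x) y = 0 := by
    rw [← hF.inner_eq_zero_iff, h, inner_smul_right, (hF.inner_eq_zero_iff _ _).2 inner_x, mul_zero]
  refine ⟨d, sub_eq_zero.1 (inner_self_eq_zero (𝕜 := ℂ).1 ?_)⟩
  rw [inner_sub_right, inner_smul_right, inner_x, inner_y, mul_zero, sub_zero]

theorem inner_self_eq_one (hF : IsOrthoMap F) (he : ‖e‖ = 1) : inner ℂ (F e) (F e) = 1 := by
  simp [inner_self_eq_norm_sq_to_K, hF.norm_map, he]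

theorem inner_map_add_ne_zero (hF : IsOrthoMap F) (he : ‖e‖ = 1) (x : (ℂ ∙ e)ᗮ) :
    inner ℂ (F e) (F (e + x)) ≠ 0 := by
  rw [Ne, hF.inner_eq_zero_iff, inner_add_right,
    Submodule.mem_orthogonal_singleton_iff_inner_right.1 x.2, inner_self_eq_norm_sq_to_K, he]
  simp

theorem map_add_eq (hF : IsOrthoMap F) (he : ‖e‖ = 1) (x : (ℂ ∙ e)ᗮ) :
    F (e + x) = inner ℂ (F e) (F (e + x)) • (F e + chart F e x) := by
  rw [chart, add_sub_cancel, smul_inv_smul₀ (hF.inner_map_add_ne_zero he x)]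

theorem inner_chart (hF : IsOrthoMap F) (he : ‖e‖ = 1) (x : (ℂ ∙ e)ᗮ) :
    inner ℂ (F e) (chart F e x) = 0 := by
  rw [chart, inner_sub_right, inner_smul_right, hF.inner_self_eq_one he,
    inv_mul_cancel₀ (hF.inner_map_add_ne_zero he x), sub_self]

theorem chart_zero (hF : IsOrthoMap F) (he : ‖e‖ = 1) : chart F e 0 = 0 := by
  rw [chart, Submodule.coe_zero, add_zero, hF.inner_self_eq_one he, inv_one, one_smul, sub_self]

theorem exists_map_eq_smul_chart (hF : IsOrthoMap F) (he : ‖e‖ = 1) (x : (ℂ ∙ e)ᗮ) :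
    ∃ c : ℂ, F x = c • chart F e x := by
  obtain ⟨p, q, h⟩ := hF.exists_map_lincomb (e + x) e 1 (-1)
  rw [one_smul, neg_one_smul, add_neg_cancel_comm, hF.map_add_eq he] at h
  have hx : inner ℂ (F e) (F x) = 0 :=
    (hF.inner_eq_zero_iff _ _).2 (Submodule.mem_orthogonal_singleton_iff_inner_right.1 x.2)
  rw [h, inner_add_right, inner_smul_right, inner_smul_right, inner_smul_right, inner_add_right,
    hF.inner_chart he, hF.inner_self_eq_one he, add_zero, mul_one, mul_one] at hx
  refine ⟨p * inner ℂ (F e) (F (e + x)), ?_⟩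
  rw [h, eq_neg_of_add_eq_zero_right hx]
  module

theorem exists_chart_eq_smul_map (hF : IsOrthoMap F) (he : ‖e‖ = 1) (x : (ℂ ∙ e)ᗮ) :
    ∃ c : ℂ, chart F e x = c • F x := by
  obtain rfl | hx := eq_or_ne x 0
  · exact ⟨0, by rw [hF.chart_zero he, zero_smul]⟩
  obtain ⟨c, hc⟩ := hF.exists_map_eq_smul_chart he x
  have hc0 : c ≠ 0 := by
    rintro rfl
    rw [zero_smul, hF.map_eq_zero_iff] at hc
    exact hx (Subtype.ext hc)
  exact ⟨c⁻¹, by rw [hc, inv_smul_smul₀ hc0]⟩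

theorem exists_chart_add_eq (hF : IsOrthoMap F) (he : ‖e‖ = 1) (x y : (ℂ ∙ e)ᗮ) :
    ∃ s : ℂ, chart F e (x + y) = chart F e x + s • chart F e y := by
  obtain ⟨p, q, h⟩ := hF.exists_map_lincomb (e + x) y 1 1
  obtain ⟨c, hc⟩ := hF.exists_map_eq_smul_chart he y
  rw [one_smul, one_smul, add_assoc, ← Submodule.coe_add, hF.map_add_eq he x,
    hF.map_add_eq he (x + y), hc] at h
  set a := inner ℂ (F e) (F (e + ((x + y : (ℂ ∙ e)ᗮ) : H)))
  set b := inner ℂ (F e) (F (e + x))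
  have ha : a ≠ 0 := hF.inner_map_add_ne_zero he (x + y)
  have hab : a = p * b := by
    simpa only [inner_add_right, inner_smul_right, hF.inner_chart he, hF.inner_self_eq_one he,
      mul_zero, add_zero, mul_one] using congrArg (inner ℂ (F e)) h
  refine ⟨a⁻¹ * q * c, add_left_cancel (a := F e) ?_⟩
  calc F e + chart F e (x + y)
      = a⁻¹ • (p • b • (F e + chart F e x) + q • c • chart F e y) := by
        rw [← h, inv_smul_smul₀ ha]
    _ = F e + (chart F e x + (a⁻¹ * q * c) • chart F e y) := by
        rw [smul_smul p b, ← hab, smul_add, inv_smul_smul₀ ha, smul_smul, smul_smul, add_assoc]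

theorem chart_add_of_linearIndependent (hF : IsOrthoMap F) (he : ‖e‖ = 1) {x y : (ℂ ∙ e)ᗮ}
    (hxy : LinearIndependent ℂ ![x, y]) : chart F e (x + y) = chart F e x + chart F e y := by
  obtain ⟨s, hs⟩ := hF.exists_chart_add_eq he x y
  obtain ⟨t, ht⟩ := hF.exists_chart_add_eq he y x
  obtain rfl | hs1 := eq_or_ne s 1
  · rw [hs, one_smul]
  exfalso
  have hx : (x : H) ≠ 0 := fun h => hxy.ne_zero 0 (Subtype.ext h)
  have chart_y : chart F e y = ((1 - t) / (1 - s)) • chart F e x := by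
    have h : (1 - s) • chart F e y = (1 - t) • chart F e x := by
      rw [sub_smul, sub_smul, one_smul, one_smul, sub_eq_sub_iff_add_eq_add, ← ht, add_comm y, hs]
    rw [div_eq_inv_mul, mul_smul, ← h, inv_smul_smul₀ (sub_ne_zero.2 hs1.symm)]
  obtain ⟨c, hc⟩ := hF.exists_map_eq_smul_chart he y
  obtain ⟨d, hd⟩ := hF.exists_chart_eq_smul_map he x
  rw [chart_y, hd, smul_smul, smul_smul] at hc
  obtain ⟨a, ha⟩ := hF.exists_eq_smul hx hc
  exact (LinearIndependent.pair_iff' fun h => hx (congrArg Subtype.val h)).1 hxy a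
    (Subtype.ext ha.symm)

theorem chart_add (hF : IsOrthoMap F) (hH : 2 < Module.rank ℂ H) (he : ‖e‖ = 1)
    (x y : (ℂ ∙ e)ᗮ) : chart F e (x + y) = chart F e x + chart F e y :=
  map_add_of_map_add_of_linearIndependent (one_lt_rank_orthogonal_singleton hH e)
    (hF.chart_zero he) (fun _ _ => hF.chart_add_of_linearIndependent he) x y

theorem inner_chart_chart (hF : IsOrthoMap F) (he : ‖e‖ = 1) {x y : (ℂ ∙ e)ᗮ}
    (hxy : inner ℂ x y = -1) : inner ℂ (chart F e x) (chart F e y) = -1 := by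
  have hy : inner ℂ e (y : H) = 0 := Submodule.mem_orthogonal_singleton_iff_inner_right.1 y.2
  have hx : inner ℂ (x : H) e = 0 := Submodule.mem_orthogonal_singleton_iff_inner_left.1 x.2
  have h : inner ℂ (F (e + x)) (F (e + y)) = 0 := by
    rw [hF.inner_eq_zero_iff, inner_add_left, inner_add_right, inner_add_right, hy, hx,
      ← Submodule.coe_inner, hxy, inner_self_eq_norm_sq_to_K, he]
    simp
  rw [hF.map_add_eq he x, hF.map_add_eq he y, inner_smul_left, inner_smul_right,
    mul_eq_zero, mul_eq_zero, map_eq_zero] at h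
  have h' := (h.resolve_left (hF.inner_map_add_ne_zero he x)).resolve_left
    (hF.inner_map_add_ne_zero he y)
  rw [inner_add_left, inner_add_right, inner_add_right, hF.inner_self_eq_one he,
    hF.inner_chart he, inner_eq_zero_symm.1 (hF.inner_chart he x)] at h'
  linear_combination h'

theorem continuous_chart (hF : IsOrthoMap F) (he : ‖e‖ = 1) : Continuous (chart F e) := by
  have hcont : Continuous fun x : (ℂ ∙ e)ᗮ => F (e + x) := by
    refine hF.continuousOn.comp_continuous (by fun_prop) fun x h0 => ?_
    refine hF.inner_map_add_ne_zero he x ?_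
    rw [hF.map_eq_zero_iff.2 h0, inner_zero_right]
  exact (((continuous_const.inner hcont).inv₀ (hF.inner_map_add_ne_zero he)).smul hcont).sub
    continuous_const

theorem exists_linearIsometry (hF : IsOrthoMap F) (hH : 2 < Module.rank ℂ H) (he : ‖e‖ = 1) :
    ∃ B : (ℂ ∙ e)ᗮ →ₗᵢ[ℝ] H', ∀ x, B x = chart F e x := by
  let B : (ℂ ∙ e)ᗮ →L[ℝ] H' := (AddMonoidHom.mk' (chart F e) (hF.chart_add hH he)).toRealLinearMap
    (hF.continuous_chart he)
  exact ⟨⟨B.toLinearMap, norm_map_of_inner_eq_neg_one B.toLinearMap fun x y hxy =>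
    hF.inner_chart_chart he hxy⟩, fun _ => rfl⟩

theorem map_I_smul_eq_or_eq (hF : IsOrthoMap F) (he : ‖e‖ = 1) {B : (ℂ ∙ e)ᗮ →ₗᵢ[ℝ] H'}
    (hB : ∀ x, B x = chart F e x) (x : (ℂ ∙ e)ᗮ) :
    B (Complex.I • x) = Complex.I • B x ∨ B (Complex.I • x) = -Complex.I • B x := by
  obtain rfl | hx := eq_or_ne x 0
  · simp
  have hx' : ‖x‖ ≠ 0 := norm_ne_zero_iff.2 hx
  obtain ⟨c, hc⟩ := hF.exists_chart_eq_smul_map he (Complex.I • x)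
  obtain ⟨d, hd⟩ := hF.exists_map_eq_smul_chart he x
  obtain ⟨τ, hτ⟩ : ∃ τ : ℂ, B (Complex.I • x) = τ • B x := ⟨c * Complex.I * d, by
    rw [hB, hB, hc, Submodule.coe_smul, hF.map_smul, hd, smul_smul, smul_smul, mul_assoc]⟩
  have norm_one_add_τ : ‖1 + τ‖ = ‖1 + Complex.I‖ := by
    have h : B ((1 + Complex.I) • x) = (1 + τ) • B x := by
      rw [add_smul, add_smul, one_smul, one_smul, map_add, hτ]
    refine mul_right_cancel₀ hx' ?_
    rw [← norm_smul (1 + Complex.I), ← B.norm_map (_ • x), h, norm_smul, B.norm_map]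
  have norm_τ : ‖τ‖ = 1 := by
    refine mul_right_cancel₀ hx' ?_
    rw [← B.norm_map, ← norm_smul, ← hτ, B.norm_map, norm_smul, Complex.norm_I, B.norm_map]
  rw [hτ]
  exact (eq_I_or_eq_neg_I norm_τ norm_one_add_τ).imp (congrArg (· • B x)) (congrArg (· • B x))

theorem forall_map_I_smul_or_forall (hF : IsOrthoMap F) (he : ‖e‖ = 1) {B : (ℂ ∙ e)ᗮ →ₗᵢ[ℝ] H'}
    (hB : ∀ x, B x = chart F e x) :
    (∀ x, B (Complex.I • x) = Complex.I • B x) ∨ ∀ x, B (Complex.I • x) = -Complex.I • B x := by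
  let B' : (ℂ ∙ e)ᗮ →+ H' := B.toLinearMap.toAddMonoidHom
  let smulHom (c : ℂ) : H' →+ H' := DistribSMul.toAddMonoidHom H' c
  exact (eq_or_eq_of_forall_eq_or_eq (f := B'.comp (DistribSMul.toAddMonoidHom _ Complex.I))
    (g := (smulHom Complex.I).comp B') (h := (smulHom (-Complex.I)).comp B')
    (hF.map_I_smul_eq_or_eq he hB)).imp DFunLike.congr_fun DFunLike.congr_fun

theorem exists_eq_smul_of_chart_eq (hF : IsOrthoMap F) (he : ‖e‖ = 1) {σ : ℂ →+* ℂ}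
    {V : H →ₛₗ[σ] H'} (hVe : V e = F e) (hV : ∀ x : (ℂ ∙ e)ᗮ, V x = chart F e x) (v : H) :
    ∃ c : ℂ, F v = c • V v := by
  let P := (ℂ ∙ e)ᗮ.orthogonalProjectionOnto
  have decomp : v = inner ℂ e v • e + (P v : H) := by
    have h := (ℂ ∙ e).starProjection_add_starProjection_orthogonal v
    rw [Submodule.starProjection_unit_singleton ℂ he] at h
    exact h.symm
  obtain ha | ha := eq_or_ne (inner ℂ e v) 0
  · obtain ⟨c, hc⟩ := hF.exists_map_eq_smul_chart he (P v)
    rw [ha, zero_smul, zero_add] at decomp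
    exact ⟨c, by rw [decomp, hc, hV]⟩
  · set a := inner ℂ e v
    obtain ⟨x, hx⟩ : ∃ x : (ℂ ∙ e)ᗮ, v = a • (e + x) :=
      ⟨a⁻¹ • P v, by rw [smul_add, Submodule.coe_smul, smul_inv_smul₀ ha, ← decomp]⟩
    have hσa : σ a ≠ 0 := (map_ne_zero σ).2 ha
    refine ⟨a * inner ℂ (F e) (F (e + x)) * (σ a)⁻¹, ?_⟩
    rw [hx, hF.map_smul, map_smulₛₗ, map_add, hVe, hV, smul_smul, inv_mul_cancel_right₀ hσa,
      mul_smul, ← hF.map_add_eq he]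

theorem exists_linearIsometryEquiv (hF : IsOrthoMap F) (he : ‖e‖ = 1) {σ : ℂ →+* ℂ}
    [RingHomInvPair σ σ] [RingHomIsometric σ] (B : (ℂ ∙ e)ᗮ →ₛₗᵢ[σ] H')
    (hB : ∀ x, B x = chart F e x) :
    ∃ V : H ≃ₛₗᵢ[σ] H', ∀ v, ∃ c : ℂ, ‖c‖ = 1 ∧ F v = c • V v := by
  obtain ⟨V, hVe, hV⟩ := exists_linearIsometry_extend he ((hF.norm_map e).trans he) B
    fun x => hB x ▸ hF.inner_chart he x
  have hFV : ∀ v, ∃ c : ℂ, F v = c • V v :=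
    hF.exists_eq_smul_of_chart_eq he (V := V.toLinearMap) hVe fun x => (hV x).trans (hB x)
  have V_surjective : Function.Surjective V := fun w => by
    obtain ⟨v, rfl⟩ := hF.surjective w
    obtain ⟨c, hc⟩ := hFV v
    exact ⟨σ c • v, by rw [map_smulₛₗ, RingHomInvPair.comp_apply_eq, hc]⟩
  refine ⟨LinearIsometryEquiv.ofSurjective V V_surjective, fun v => ?_⟩
  obtain rfl | hv := eq_or_ne v 0
  · exact ⟨1, norm_one, by rw [hF.map_eq_zero_iff.2 rfl, map_zero, smul_zero]⟩
  obtain ⟨c, hc⟩ := hFV v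
  have hnorm := congrArg norm hc
  rw [hF.norm_map, norm_smul, V.norm_map] at hnorm
  exact ⟨c, (mul_eq_right₀ (norm_ne_zero_iff.2 hv)).1 hnorm.symm, hc⟩

theorem unitary_or_antiunitary (hF : IsOrthoMap F) (hH : 2 < Module.rank ℂ H) :
    (∃ V : H ≃ₗᵢ[ℂ] H', ∀ v, ∃ c : ℂ, ‖c‖ = 1 ∧ F v = c • V v) ∨
      ∃ V : H ≃ₛₗᵢ[starRingEnd ℂ] H', ∀ v, ∃ c : ℂ, ‖c‖ = 1 ∧ F v = c • V v := by
  have : Nontrivial H := rank_pos_iff_nontrivial.1 (two_pos.trans hH)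
  obtain ⟨e, he⟩ := exists_norm_eq H zero_le_one
  obtain ⟨B, hB⟩ := hF.exists_linearIsometry hH he
  refine (hF.forall_map_I_smul_or_forall he hB).imp (fun hI => ?_) fun hI => ?_
  · exact hF.exists_linearIsometryEquiv he ⟨⟨⟨B, map_add B⟩, map_smul_of_map_smul_I B.toLinearMap
      (σ := RingHom.id ℂ) (fun _ => rfl) hI⟩, B.norm_map⟩ hB
  · exact hF.exists_linearIsometryEquiv he ⟨⟨⟨B, map_add B⟩, map_smul_of_map_smul_I B.toLinearMap
      (σ := starRingEnd ℂ) Complex.conj_ofReal (by simpa using hI)⟩, B.norm_map⟩ hB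

end IsOrthoMap

end Uhlhorn

section Lifting

variable {E : Type*} [NormedAddCommGroup E] [NormedSpace ℝ E]

open Classical in
theorem exists_lift_of_starConvex {s : Set E} {p : E} (hs : StarConvex ℝ p s) (ho : IsOpen s)
    (hp : p ∈ s) {c : E → Circle} (hc : ContinuousOn c s) :
    ∃ h : E → ℝ, ContinuousOn h s ∧ ∀ x ∈ s, Circle.exp (h x) = c x := by
  have := hs.contractibleSpace ⟨p, hp⟩
  have := ho.locallyPathConnectedSpace
  obtain ⟨t, ht⟩ := Circle.exp_surjective (c p)
  obtain ⟨f, ⟨-, hf⟩, -⟩ := Circle.isCoveringMap_exp.existsUnique_continuousMap_lifts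
    ⟨s.domRestrict c, continuousOn_iff_continuous_domRestrict.1 hc⟩ ⟨p, hp⟩ t ht
  refine ⟨fun x => if hx : x ∈ s then f ⟨x, hx⟩ else 0, ?_, fun x hx => ?_⟩
  · rw [continuousOn_iff_continuous_domRestrict]
    convert! map_continuous f
    ext x
    exact dif_pos x.2
  · simp only [dif_pos hx]
    exact congrFun hf ⟨x, hx⟩

open Classical in
theorem exists_lift_union {X : Type*} [TopologicalSpace X] {s t : Set X} (hs : IsOpen s)
    (ht : IsOpen t) (hst : IsConnected (s ∩ t)) {c : X → Circle}
    (hcs : ∃ f : X → ℝ, ContinuousOn f s ∧ ∀ x ∈ s, Circle.exp (f x) = c x)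
    (hct : ∃ g : X → ℝ, ContinuousOn g t ∧ ∀ x ∈ t, Circle.exp (g x) = c x) :
    ∃ h : X → ℝ, ContinuousOn h (s ∪ t) ∧ ∀ x ∈ s ∪ t, Circle.exp (h x) = c x := by
  obtain ⟨f, hf, hfc⟩ := hcs
  obtain ⟨g₀, hg₀, hg₀c⟩ := hct
  obtain ⟨a, ha⟩ := hst.nonempty
  obtain ⟨g, hg, hgc, hga⟩ : ∃ g : X → ℝ, ContinuousOn g t ∧
      (∀ x ∈ t, Circle.exp (g x) = c x) ∧ f a = g a := by
    refine ⟨fun x => g₀ x + (f a - g₀ a), hg₀.add continuousOn_const, fun x hx => ?_, by simp⟩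
    rw [Circle.exp_add, Circle.exp_sub, hg₀c x hx, hfc a ha.1, hg₀c a ha.2, div_self', mul_one]
  have hfg : (s ∩ t).EqOn f g := Circle.isCoveringMap_exp.eqOn_of_comp_eqOn hst.isPreconnected
    (hf.mono Set.inter_subset_left) (hg.mono Set.inter_subset_right)
    (fun x hx => (hfc x hx.1).trans (hgc x hx.2).symm) ha hga
  have eqOn_s : s.EqOn (s.piecewise f g) f := Set.piecewise_eqOn s f g
  have eqOn_t : t.EqOn (s.piecewise f g) g := fun x hx => by
    by_cases hxs : x ∈ s
    · exact (eqOn_s hxs).trans (hfg ⟨hxs, hx⟩)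
    · exact Set.piecewise_eq_of_notMem s f g hxs
  refine ⟨s.piecewise f g, (hf.congr eqOn_s).union_of_isOpen (hg.congr eqOn_t) hs ht, ?_⟩
  rintro x (hx | hx)
  · rw [eqOn_s hx, hfc x hx]
  · rw [eqOn_t hx, hgc x hx]

/-- The complement of the closed half-line opposite to `p`. -/
def slitSpace (p : E) : Set E := ((fun t : ℝ => t • p) '' Set.Iic 0)ᶜ

theorem isOpen_slitSpace {p : E} (hp : p ≠ 0) : IsOpen (slitSpace p) :=
  ((isClosedEmbedding_smul_left hp).isClosedMap _ isClosed_Iic).isOpen_compl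

theorem starConvex_slitSpace {p : E} (hp : p ≠ 0) : StarConvex ℝ p (slitSpace p) := by
  rintro x hx a b ha hb hab ⟨t, ht, hx'⟩
  rw [Set.mem_Iic] at ht
  have hbx : b • x = (t - a) • p := by
    rw [sub_smul]
    exact eq_sub_of_add_eq' hx'.symm
  obtain rfl | hb := hb.eq_or_lt
  · rw [zero_smul, eq_comm, smul_eq_zero, or_iff_left hp] at hbx
    linarith
  · refine hx ⟨(t - a) / b, div_nonpos_of_nonpos_of_nonneg (by linarith) hb.le, ?_⟩
    simp only [div_eq_inv_mul, mul_smul, ← hbx, inv_smul_smul₀ hb.ne']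

theorem mem_slitSpace_self {p : E} (hp : p ≠ 0) : p ∈ slitSpace p := by
  rintro ⟨t, ht, h⟩
  obtain rfl : t = 1 := smul_left_injective ℝ hp (h.trans (one_smul ℝ p).symm)
  exact zero_lt_one.not_ge (Set.mem_Iic.1 ht)

theorem slitSpace_union_neg {p : E} (hp : p ≠ 0) : slitSpace p ∪ slitSpace (-p) = {0}ᶜ := by
  rw [slitSpace, slitSpace, ← Set.compl_inter, compl_inj_iff]
  refine Set.eq_singleton_iff_unique_mem.2 ⟨⟨⟨0, by simp⟩, ⟨0, by simp⟩⟩, ?_⟩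
  rintro _ ⟨⟨t, ht, rfl⟩, ⟨s, hs, hst⟩⟩
  have hst' : -s = t := smul_left_injective ℝ hp ((neg_smul s p).trans (smul_neg s p ▸ hst))
  rw [Set.mem_Iic] at hs ht
  obtain rfl : t = 0 := by linarith
  exact zero_smul ℝ p

theorem slitSpace_inter_neg (p : E) :
    slitSpace p ∩ slitSpace (-p) = ((ℝ ∙ p : Submodule ℝ E) : Set E)ᶜ := by
  rw [slitSpace, slitSpace, ← Set.compl_union, compl_inj_iff]
  ext v
  rw [SetLike.mem_coe, Submodule.mem_span_singleton]
  constructor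
  · rintro (⟨t, -, rfl⟩ | ⟨t, -, rfl⟩)
    · exact ⟨t, rfl⟩
    · exact ⟨-t, by simp⟩
  · rintro ⟨t, rfl⟩
    exact (le_total t 0).imp (fun ht => ⟨t, ht, rfl⟩) fun ht => ⟨-t, by simpa, by simp⟩

theorem one_lt_rank_quotient_span_singleton (hE : 2 < Module.rank ℝ E) (p : E) :
    1 < Module.rank ℝ (E ⧸ (ℝ ∙ p)) := by
  by_contra! h
  have hp : Module.rank ℝ (ℝ ∙ p) ≤ 1 :=
    (rank_span_le (R := ℝ) {p}).trans (Cardinal.mk_singleton p).le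
  refine ((add_le_add h hp).trans_lt (by rwa [one_add_one_eq_two])).ne ?_
  exact Submodule.rank_quotient_add_rank (ℝ ∙ p)

theorem exists_lift_compl_singleton_zero (hE : 2 < Module.rank ℝ E) {c : E → Circle}
    (hc : ContinuousOn c {0}ᶜ) :
    ∃ h : E → ℝ, ContinuousOn h {0}ᶜ ∧ ∀ x ≠ 0, Circle.exp (h x) = c x := by
  have : Nontrivial E := rank_pos_iff_nontrivial.1 (two_pos.trans hE)
  obtain ⟨p, hp⟩ := exists_ne (0 : E)
  have hp' : -p ≠ 0 := neg_ne_zero.2 hp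
  have hconn : IsConnected (slitSpace p ∩ slitSpace (-p)) := by
    rw [slitSpace_inter_neg]
    exact isConnected_compl_of_one_lt_codim (one_lt_rank_quotient_span_singleton hE p)
  rw [← slitSpace_union_neg hp] at hc
  have hlift := exists_lift_union (isOpen_slitSpace hp) (isOpen_slitSpace hp') hconn
    (exists_lift_of_starConvex (starConvex_slitSpace hp) (isOpen_slitSpace hp)
      (mem_slitSpace_self hp) (hc.mono Set.subset_union_left))
    (exists_lift_of_starConvex (starConvex_slitSpace hp') (isOpen_slitSpace hp')
      (mem_slitSpace_self hp') (hc.mono Set.subset_union_right))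
  rwa [slitSpace_union_neg hp] at hlift

open Classical in
theorem exists_state_lift (hE : 2 < Module.rank ℝ E) {c : State E → Circle} (hc : Continuous c) :
    ∃ h : State E → ℝ, Continuous h ∧ ∀ φ, Circle.exp (h φ) = c φ := by
  let C : E → Circle := fun v => if hv : v = 0 then 1 else c (normalize v hv)
  have C_continuousOn : ContinuousOn C {0}ᶜ := by
    have hC : ({0}ᶜ : Set E).domRestrict C =
        fun v : ({0}ᶜ : Set E) => c (normalize v v.2) := funext fun v => dif_neg v.2
    rw [continuousOn_iff_continuous_domRestrict, hC]
    refine hc.comp (Continuous.subtype_mk ?_ _)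
    exact (continuous_const.div continuous_subtype_val.norm fun v => norm_ne_zero_iff.2 v.2).smul
      continuous_subtype_val
  obtain ⟨h, hh, hhC⟩ := exists_lift_compl_singleton_zero hE C_continuousOn
  refine ⟨fun φ => h φ, hh.comp_continuous continuous_subtype_val fun φ => φ.coe_ne_zero,
    fun φ => ?_⟩
  rw [hhC _ φ.coe_ne_zero]
  simp only [C, dif_neg φ.coe_ne_zero, normalize_coe]

end Lifting

section SquareRoot

open scoped ComplexStarModule

theorem exists_symmetry {H : Type*} [NormedAddCommGroup H] [InnerProductSpace ℂ H]
    [CompleteSpace H] {Y : H →L[ℂ] H} (hY : IsSelfAdjoint Y) :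
    ∃ J : H →L[ℂ] H, IsSelfAdjoint J ∧ J * J = 1 ∧ J * CFC.abs Y = Y ∧
      ∀ A : H →L[ℂ] H, IsSelfAdjoint A → Commute Y A → Commute A J := by
  let K : Submodule ℂ H := (Y⁺).ker
  have : CompleteSpace K := (Y⁺).isClosed_ker.completeSpace_coe
  let P := K.starProjection
  have hPs : IsSelfAdjoint P := isSelfAdjoint_starProjection K
  have hPP : P * P = P := K.isIdempotentElem_starProjection
  have P_mul : ∀ B : H →L[ℂ] H, Y⁺ * B = 0 → P * B = B := fun B hB => by
    ext x
    exact Submodule.starProjection_eq_self_iff.2 (DFunLike.congr_fun hB x)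
  have hYP : Y⁺ * P = 0 := by
    ext x
    exact (K.starProjection_apply_mem x : (Y⁺) (P x) = 0)
  have hPY : P * Y⁺ = 0 := by
    have := congrArg star hYP
    rwa [star_mul, (CFC.posPart_nonneg Y).isSelfAdjoint.star_eq, hPs.star_eq, star_zero] at this
  have hPY' : P * Y⁻ = Y⁻ := P_mul _ (CFC.posPart_mul_negPart Y)
  refine ⟨1 - 2 • P, (IsSelfAdjoint.one _).sub ((IsSelfAdjoint.all (2 : ℕ)).smul hPs), ?_, ?_,
    fun A hA hYA => ?_⟩
  · calc (1 - 2 • P) * (1 - 2 • P) = 1 - 4 • P + 4 • (P * P) := by noncomm_ring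
      _ = 1 := by rw [hPP, sub_add_cancel]
  · calc (1 - 2 • P) * CFC.abs Y = Y⁺ + Y⁻ - 2 • (P * Y⁺) - 2 • (P * Y⁻) := by
          rw [← CFC.posPart_add_negPart Y]
          noncomm_ring
      _ = Y⁺ - Y⁻ := by
          rw [hPY, hPY']
          noncomm_ring
      _ = Y := CFC.posPart_sub_negPart Y
  · have hYA' : Commute (Y⁺) A := hYA.cfcₙ_real _
    have hPAP : P * (A * P) = A * P :=
      P_mul _ (by rw [← mul_assoc, hYA'.eq, mul_assoc, hYP, mul_zero])
    have hPAP' := congrArg star hPAP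
    rw [star_mul, star_mul, hA.star_eq, hPs.star_eq] at hPAP'
    have hAP : Commute A P := hPAP.symm.trans ((mul_assoc _ _ _).symm.trans hPAP')
    exact (Commute.one_right A).sub_right (hAP.smul_right 2)

theorem add_I_smul_mul_self {A : Type*} [Ring A] [Algebra ℂ A] {c s : A} (h : Commute c s) :
    (c + Complex.I • s) * (c + Complex.I • s) = c * c - s * s + (2 * Complex.I) • (c * s) := by
  rw [add_mul, mul_add, mul_add, smul_mul_smul_comm, Complex.I_mul_I, mul_smul_comm,
    smul_mul_assoc, h.eq]
  module

theorem add_I_smul_mem_unitary {A : Type*} [Ring A] [StarRing A] [Algebra ℂ A] [StarModule ℂ A]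
    {c s : A} (hc : IsSelfAdjoint c) (hs : IsSelfAdjoint s) (h : Commute c s)
    (hcs : c * c + s * s = 1) : c + Complex.I • s ∈ unitary A := by
  have hre : (ℜ (c + Complex.I • s) : A) = c := by
    simp [hs.imaginaryPart, hc.coe_realPart]
  have him : (ℑ (c + Complex.I • s) : A) = s := by
    simp [hc.imaginaryPart, hs.coe_realPart]
  rw [mem_unitary_iff_isStarNormal_and_realPart_sq_add_imaginaryPart_sq_eq_one,
    isStarNormal_iff_commute_realPart_imaginaryPart, hre, him, sq, sq]
  exact ⟨h, hcs⟩

variable {A : Type*} [CStarAlgebra A] [PartialOrder A] [StarOrderedRing A] {u : A}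

theorem cfcAbs_half_smul_one_add_mul_self (hu : u ∈ unitary A) :
    CFC.abs ((2⁻¹ : ℝ) • (1 + u)) * CFC.abs ((2⁻¹ : ℝ) • (1 + u)) =
      (2⁻¹ : ℝ) • (1 + (ℜ u : A)) := by
  rw [CFC.abs_mul_abs, star_smul, star_add, star_one, smul_mul_smul_comm, add_mul, mul_add,
    mul_add, Unitary.star_mul_self_of_mem hu, one_mul, mul_one, one_mul, realPart_apply_coe,
    star_trivial]
  module

theorem cfcAbs_half_smul_one_add_mul_cfcAbs_half_smul_one_sub (hu : u ∈ unitary A) :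
    CFC.abs ((2⁻¹ : ℝ) • (1 + u)) * CFC.abs ((2⁻¹ : ℝ) • (1 + -u)) =
      (2⁻¹ : ℝ) • CFC.abs (ℑ u : A) := by
  have hcomm : Commute u (star u) := (isStarNormal_of_mem_unitary hu).star_comm_self.symm
  have hone : Commute (1 + u) (1 + -u) :=
    (Commute.one_right _).add_right ((Commute.one_left u).add_left (Commute.refl u)).neg_right
  have hstar : Commute (1 + u) (star (1 + -u)) := by
    rw [star_add, star_one, star_neg]
    exact (Commute.one_right _).add_right ((Commute.one_left _).add_left hcomm).neg_right
  have hprod : (2⁻¹ : ℝ) • (1 + u) * (2⁻¹ : ℝ) • (1 + -u) =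
      u * ((-Complex.I / 2) • (ℑ u : A)) := by
    have hI : -Complex.I / 2 * -Complex.I = -2⁻¹ := by linear_combination Complex.I_sq / 2
    rw [imaginaryPart_apply_coe, smul_mul_smul_comm, mul_smul_comm, mul_smul_comm, mul_smul_comm,
      mul_sub, Unitary.mul_star_self_of_mem hu, smul_smul, hI]
    have hsq : (1 + u) * (1 + -u) = 1 - u * u := by noncomm_ring
    rw [hsq]
    module
  rw [← Commute.cfcAbs_mul_eq ((hone.smul_left _).smul_right _) (by
    rw [star_smul]; exact (hstar.smul_left _).smul_right _), hprod,
    CFC.abs, star_mul, mul_assoc, ← mul_assoc (star u), Unitary.star_mul_self_of_mem hu, one_mul,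
    ← CFC.abs, CFC.abs_smul]
  simp

/-- With `c = |1 + u| / 2` and `s = J |1 - u| / 2`, where `J` carries the sign of the imaginary
part of `u`, the half-angle formulas make `c + i s` a square root of `u`. -/
theorem exists_unitary_mul_self_eq (hu : u ∈ unitary A) {J : A} (hJ : IsSelfAdjoint J)
    (hJJ : J * J = 1) (hJu : J * CFC.abs (ℑ u : A) = ℑ u)
    (hJcomm : ∀ a : A, IsSelfAdjoint a → Commute (ℑ u : A) a → Commute a J) :
    ∃ w ∈ unitary A, w * w = u := by
  set c := CFC.abs ((2⁻¹ : ℝ) • (1 + u))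
  set b := CFC.abs ((2⁻¹ : ℝ) • (1 + -u))
  have hc : IsSelfAdjoint c := (CFC.abs_nonneg _).isSelfAdjoint
  have hb : IsSelfAdjoint b := (CFC.abs_nonneg _).isSelfAdjoint
  have hcc : c * c = (2⁻¹ : ℝ) • (1 + (ℜ u : A)) := cfcAbs_half_smul_one_add_mul_self hu
  have hbb : b * b = (2⁻¹ : ℝ) • (1 - (ℜ u : A)) := by
    have hu' : -u ∈ unitary A := (-(⟨u, hu⟩ : unitary A)).2
    rw [cfcAbs_half_smul_one_add_mul_self hu', map_neg, AddSubgroup.coe_neg, ← sub_eq_add_neg]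
  have hcb : c * b = (2⁻¹ : ℝ) • CFC.abs (ℑ u : A) :=
    cfcAbs_half_smul_one_add_mul_cfcAbs_half_smul_one_sub hu
  have huY : Commute u (ℑ u : A) := by
    rw [imaginaryPart_apply_coe]
    exact (((Commute.refl u).sub_right
      (isStarNormal_of_mem_unitary hu).star_comm_self.symm).smul_right _).smul_right _
  have habs (v : A) (hv : Commute v (ℑ u : A)) : Commute (CFC.abs v) J :=
    hJcomm _ (CFC.abs_nonneg v).isSelfAdjoint (hv.cfcAbs_right (by rwa [(ℑ u).2.star_eq]))
  have hcJ : Commute c J := habs _ (((Commute.one_left _).add_left huY).smul_left _)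
  have hbJ : Commute b J := habs _ (((Commute.one_left _).add_left huY.neg_left).smul_left _)
  have hcomm : Commute c b := by
    rw [hc.commute_iff hb, hcb]
    exact (IsSelfAdjoint.all _).smul (CFC.abs_nonneg _).isSelfAdjoint
  have hs : IsSelfAdjoint (J * b) := (hJ.commute_iff hb).1 hbJ.symm
  have hcs : Commute c (J * b) := hcJ.mul_right hcomm
  have hcs' : c * (J * b) = (2⁻¹ : ℝ) • (ℑ u : A) := by
    rw [← mul_assoc, hcJ.eq, mul_assoc, hcb, mul_smul_comm, hJu]
  have hss : J * b * (J * b) = b * b := by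
    rw [mul_assoc, ← mul_assoc b, hbJ.eq, mul_assoc, ← mul_assoc J, hJJ, one_mul]
  refine ⟨c + Complex.I • (J * b), add_I_smul_mem_unitary hc hs hcs ?_, ?_⟩
  · rw [hss, hcc, hbb]
    module
  · rw [add_I_smul_mul_self hcs, hss, hcc, hbb, hcs']
    conv_rhs => rw [← realPart_add_I_smul_imaginaryPart u]
    module

theorem exists_linearIsometryEquiv_sq_eq {H : Type*} [NormedAddCommGroup H]
    [InnerProductSpace ℂ H] [CompleteSpace H] (V : H ≃ₗᵢ[ℂ] H) : ∃ W : H ≃ₗᵢ[ℂ] H, W * W = V := by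
  obtain ⟨u, rfl⟩ := Unitary.linearIsometryEquiv.surjective V
  obtain ⟨J, hJ, hJJ, hJu, hJcomm⟩ := exists_symmetry (ℑ (u : H →L[ℂ] H)).2
  obtain ⟨w, hw, hwu⟩ := exists_unitary_mul_self_eq u.2 hJ hJJ hJu hJcomm
  exact ⟨Unitary.linearIsometryEquiv ⟨w, hw⟩,
    (map_mul _ _ _).symm.trans (congrArg _ (Subtype.ext hwu))⟩

end SquareRoot

section UnitaryTransformation

variable {H : Type*} [NormedAddCommGroup H] [InnerProductSpace ℂ H] {k : ℕ∞}

/-- The restriction of a unitary map to the state space. -/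
def ofUnitary (V : H ≃ₗᵢ[ℂ] H) : Equiv.Perm (State H) where
  toFun φ := ⟨V φ, by simp⟩
  invFun φ := ⟨V.symm φ, by simp⟩
  left_inv φ := Subtype.ext (V.symm_apply_apply φ)
  right_inv φ := Subtype.ext (V.apply_symm_apply φ)

@[simp] theorem coe_ofUnitary (V : H ≃ₗᵢ[ℂ] H) (φ : State H) : (ofUnitary V φ : H) = V φ := rfl

theorem ofUnitary_mul (V W : H ≃ₗᵢ[ℂ] H) : ofUnitary (V * W) = ofUnitary V * ofUnitary W := rfl

theorem isHilbertAutomorphism_ofUnitary (V : H ≃ₗᵢ[ℂ] H) :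
    IsHilbertAutomorphism k (ofUnitary V) where
  diffeo := ⟨isCk_of_contDiff (V.toContinuousLinearEquiv.contDiff.restrict_scalars ℝ),
    isCk_of_contDiff (V.symm.toContinuousLinearEquiv.contDiff.restrict_scalars ℝ)⟩
  commutes θ φ := Subtype.ext (map_smul V _ _)
  orthogonality φ ψ h := by
    rwa [realInner, coe_ofUnitary, coe_ofUnitary, V.inner_map_map]
  superposition φ ψ _ t χ hχ := by
    simp only [coe_ofUnitary, hχ, ← Complex.coe_smul, map_add, map_smul]

end UnitaryTransformation

section PhaseShift

variable {H : Type*} [NormedAddCommGroup H] [InnerProductSpace ℂ H] {k : ℕ∞} {h : State H → ℝ}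

theorem rho_rho (s t : ℝ) (φ : State H) : rho s (rho t φ) = rho (s + t) φ := by
  ext
  simp only [coe_rho, smul_smul, ← Complex.exp_add, Complex.ofReal_add, add_mul]

theorem rho_zero (φ : State H) : rho 0 φ = φ := by
  ext
  simp

theorem rho_two_pi (φ : State H) : rho (2 * Real.pi) φ = φ := by
  ext
  simp

/-- The phase shift `φ ↦ e^{-i h(φ)} φ` by a function that is constant on the orbits. -/
def ofPhase (h : State H → ℝ) (hh : ∀ θ φ, h (rho θ φ) = h φ) : Equiv.Perm (State H) where
  toFun φ := rho (-h φ) φ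
  invFun φ := rho (h φ) φ
  left_inv φ := by simp only [hh, rho_rho, add_neg_cancel, rho_zero]
  right_inv φ := by simp only [hh, rho_rho, neg_add_cancel, rho_zero]

theorem ofPhase_apply (hh : ∀ θ φ, h (rho θ φ) = h φ) (φ : State H) :
    ofPhase h hh φ = rho (-h φ) φ := rfl

theorem coe_ofPhase (hh : ∀ θ φ, h (rho θ φ) = h φ) (φ : State H) :
    (ofPhase h hh φ : H) = Complex.exp (-Complex.I * (h φ : ℂ)) • (φ : H) := by
  rw [ofPhase_apply, coe_rho, Complex.ofReal_neg, neg_mul, neg_mul, mul_comm]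

theorem ofPhase_div_two_sq (hh : ∀ θ φ, h (rho θ φ) = h φ) :
    ofPhase (fun φ => h φ / 2) (fun θ φ => by rw [hh]) ^ 2 = ofPhase h hh := by
  ext1 φ
  rw [sq, Equiv.Perm.mul_apply, ofPhase_apply, ofPhase_apply, hh, rho_rho, ofPhase_apply, ← neg_add,
    add_halves]

theorem isCk_rho (hk : IsCk k h) : IsCk k fun φ => (rho (h φ) φ : H) := by
  have hsmul : ContDiff ℝ k fun p : ℝ × H => Complex.exp ((p.1 : ℂ) * Complex.I) • p.2 :=
    (((Complex.ofRealCLM.contDiff.comp contDiff_fst).mul contDiff_const).cexp).smul contDiff_snd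
  exact (hk.prodMk (isCk_of_contDiff contDiff_id)).contDiff_comp hsmul

theorem isInternalEquivalence_ofPhase (hh : ∀ θ φ, h (rho θ φ) = h φ) (hk : IsCk k h) :
    IsInternalEquivalence k (ofPhase h hh) where
  diffeo := ⟨isCk_rho (hk.contDiff_comp contDiff_neg), isCk_rho hk⟩
  orbit_into_itself φ := by
    rintro _ ⟨_, ⟨θ, rfl⟩, rfl⟩
    exact ⟨_, (rho_rho (-h (rho θ φ)) θ φ).symm⟩
  commutes θ φ := by
    rw [ofPhase_apply, ofPhase_apply, hh, rho_rho, rho_rho, add_comm]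

end PhaseShift

section PhaseFactor

variable {H : Type*} [NormedAddCommGroup H] [InnerProductSpace ℂ H]

theorem eq_inner_div_inner_self {v w : H} {c : ℂ} (hv : v ≠ 0) (h : w = c • v) :
    c = inner ℂ v w / inner ℂ v v := by
  rw [h, inner_smul_right, mul_div_cancel_right₀ _ (inner_self_ne_zero.2 hv)]

theorem exists_continuous_phase {E : Type*} [NormedAddCommGroup E] [NormedSpace ℝ E]
    (hE : 2 < Module.rank ℝ E) {f g : State E → H} (hf : Continuous f) (hg : Continuous g)
    (hf0 : ∀ φ, f φ ≠ 0) (hfg : ∀ φ, ∃ c : ℂ, ‖c‖ = 1 ∧ g φ = c • f φ) :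
    ∃ h : State E → ℝ, Continuous h ∧ ∀ φ, g φ = Complex.exp (h φ * Complex.I) • f φ := by
  choose c hc hgc using hfg
  have c_continuous : Continuous c := by
    rw [funext fun φ => eq_inner_div_inner_self (hf0 φ) (hgc φ)]
    exact (hf.inner hg).div (hf.inner hf) fun φ => inner_self_ne_zero.2 (hf0 φ)
  obtain ⟨h, h_continuous, hexp⟩ := exists_state_lift hE
    (c := fun φ => ⟨c φ, mem_sphere_zero_iff_norm.2 (hc φ)⟩) (c_continuous.subtype_mk _)
  refine ⟨h, h_continuous, fun φ => ?_⟩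
  rw [← Circle.coe_exp, hexp]
  exact hgc φ

theorem map_rho_eq_add_mul {h : State H → ℝ} (hh : Continuous h) {φ : State H} {a : ℝ}
    (hexp : ∀ θ : ℝ, Complex.exp (h (rho θ φ) * Complex.I) =
      Complex.exp ((h φ + a * θ : ℝ) * Complex.I)) (θ : ℝ) : h (rho θ φ) = h φ + a * θ := by
  have rho_continuous : Continuous fun θ : ℝ => rho θ φ := Continuous.subtype_mk (by fun_prop) _
  have line_continuous : Continuous fun θ : ℝ => h φ + a * θ := by fun_prop
  exact Circle.isCoveringMap_exp.eqOn_of_comp_eqOn isPreconnected_univ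
    (hh.comp rho_continuous).continuousOn line_continuous.continuousOn
    (fun θ _ => Circle.ext (by simpa only [Function.comp_apply, Circle.coe_exp] using hexp θ))
    (Set.mem_univ 0) (by simp [rho_zero]) (Set.mem_univ θ)

theorem two_lt_rank_real_of_one_lt_rank_complex (hH : 1 < Module.rank ℂ H) :
    2 < Module.rank ℝ H := by
  have two_le : 2 ≤ Module.rank ℂ H := Cardinal.two_le_iff_one_lt.2 hH
  calc (2 : Cardinal) < 2 * 2 := by norm_num
    _ ≤ 2 * Module.rank ℂ H := by gcongr
    _ = Module.rank ℝ H := (rank_real_of_complex H).symm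

theorem map_eq_smul_map_rho (V : H ≃ₛₗᵢ[starRingEnd ℂ] H) (θ : ℝ) (φ : State H) :
    V φ = Complex.exp (θ * Complex.I) • V (rho θ φ) := by
  rw [coe_rho, V.map_smulₛₗ, ← Complex.exp_conj, smul_smul, ← Complex.exp_add]
  simp

/-- The phase factor would have degree two on the orbits, which are contractible in the sphere. -/
theorem not_isAntiunitaryType (hH : 1 < Module.rank ℂ H) {Φ : Equiv.Perm (State H)}
    (hΦ : Continuous Φ) (hcomm : CommutesWithPhase Φ) : ¬ IsAntiunitaryType Φ := by
  rintro ⟨V, hV⟩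
  have V_ne : ∀ φ : State H, V φ ≠ 0 := fun φ => by simpa using φ.coe_ne_zero
  obtain ⟨h, h_continuous, hΦV⟩ := exists_continuous_phase
    (two_lt_rank_real_of_one_lt_rank_complex hH) (f := fun φ : State H => V φ)
    (g := fun φ => (Φ φ : H)) (V.continuous.comp continuous_subtype_val)
    (continuous_subtype_val.comp hΦ) V_ne hV
  have : Nontrivial H := rank_pos_iff_nontrivial.1 (one_pos.trans hH)
  obtain ⟨v, hv⟩ := exists_ne (0 : H)
  let φ := normalize v hv
  have exp_rho : ∀ θ : ℝ, Complex.exp (h (rho θ φ) * Complex.I) =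
      Complex.exp ((h φ + 2 * θ : ℝ) * Complex.I) := fun θ => by
    refine smul_left_injective ℂ (V_ne (rho θ φ)) ?_
    calc Complex.exp (h (rho θ φ) * Complex.I) • V (rho θ φ)
        = Complex.exp (θ * Complex.I) • Complex.exp (h φ * Complex.I) • V φ := by
          rw [← hΦV, hcomm, coe_rho, hΦV]
      _ = Complex.exp ((h φ + 2 * θ : ℝ) * Complex.I) • V (rho θ φ) := by
          rw [map_eq_smul_map_rho V θ φ, smul_smul, smul_smul, ← Complex.exp_add,
            ← Complex.exp_add]
          congr 2
          push_cast
          ring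
  have h_two_pi := map_rho_eq_add_mul h_continuous exp_rho (2 * Real.pi)
  rw [rho_two_pi] at h_two_pi
  linarith [Real.pi_pos]

theorem isCk_of_isCk_exp {k : ℕ∞} {h : State H → ℝ} (hh : Continuous h)
    (hexp : IsCk k fun φ => Complex.exp (h φ * Complex.I)) : IsCk k h := by
  refine hexp.of_eventually_comp fun φ => ?_
  let rot : ℂ → ℂ := fun z => z * Complex.exp (-(h φ * Complex.I))
  have rot_contDiff : ContDiff ℝ k rot := contDiff_id.mul contDiff_const
  have log_contDiffOn : ContDiffOn ℝ k Complex.log Complex.slitPlane := fun z hz =>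
    ((Complex.contDiffAt_log (n := k) hz).restrict_scalars ℝ).contDiffWithinAt
  have rot_exp : ∀ t : ℝ, rot (Complex.exp (t * Complex.I)) =
      Complex.exp ((t - h φ : ℝ) * Complex.I) := fun t => by
    rw [Complex.ofReal_sub, sub_mul, sub_eq_add_neg, Complex.exp_add]
  refine ⟨fun z => h φ + (Complex.log (rot z)).im, rot ⁻¹' Complex.slitPlane,
    Complex.isOpen_slitPlane.preimage rot_contDiff.continuous, ?_,
    contDiffOn_const.add (Complex.imCLM.contDiff.comp_contDiffOn
      (log_contDiffOn.comp rot_contDiff.contDiffOn fun z hz => hz)), ?_⟩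
  · simp [rot_exp]
  · filter_upwards [hh.continuousAt.preimage_mem_nhds
      (Metric.ball_mem_nhds (h φ) Real.pi_pos)] with ψ hψ
    rw [Set.mem_preimage, Metric.mem_ball, Real.dist_eq, abs_lt] at hψ
    rw [rot_exp, Complex.log_im, ← Circle.coe_exp, Circle.arg_exp hψ.1 hψ.2.le, add_sub_cancel]

theorem IsUnitaryType.exists_phase (hH : 1 < Module.rank ℂ H) {k : ℕ∞} {Φ : Equiv.Perm (State H)}
    (hΦ : IsCk k fun φ => (Φ φ : H)) (hcomm : CommutesWithPhase Φ) (hunitary : IsUnitaryType Φ) :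
    ∃ (V : H ≃ₗᵢ[ℂ] H) (h : State H → ℝ), IsCk k h ∧
      (∀ (θ : ℝ) (φ : State H), h (rho θ φ) = h φ) ∧
      ∀ φ : State H, (Φ φ : H) = V (Complex.exp (-Complex.I * (h φ : ℂ)) • (φ : H)) := by
  obtain ⟨V, hV⟩ := hunitary
  have V_ne : ∀ φ : State H, V φ ≠ 0 := fun φ => by simpa using φ.coe_ne_zero
  have V_isCk : IsCk k fun φ : State H => V φ :=
    isCk_of_contDiff (V.toContinuousLinearEquiv.contDiff.restrict_scalars ℝ)
  obtain ⟨h, h_continuous, hΦV⟩ := exists_continuous_phase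
    (two_lt_rank_real_of_one_lt_rank_complex hH) V_isCk.continuous hΦ.continuous V_ne hV
  have exp_isCk : IsCk k fun φ => Complex.exp (h φ * Complex.I) := by
    have hexp : ∀ φ, Complex.exp (h φ * Complex.I) = inner ℂ (V φ) (Φ φ : H) / 2 := fun φ => by
      rw [eq_inner_div_inner_self (V_ne φ) (hΦV φ), inner_self_eq_norm_sq_to_K, V.norm_map,
        φ.norm_eq, ← RCLike.ofReal_pow, Real.sq_sqrt zero_le_two, RCLike.ofReal_ofNat]
    rw [funext hexp]
    exact (V_isCk.prodMk hΦ).contDiff_comp (g := fun p : H × H => inner ℂ p.1 p.2 / 2)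
      ((contDiff_fst.inner ℂ contDiff_snd).div_const 2)
  have h_rho : ∀ θ φ, h (rho θ φ) = h φ := fun θ φ => by
    have := map_rho_eq_add_mul h_continuous (φ := φ) (a := 0) (fun θ => ?_) θ
    · rwa [zero_mul, add_zero] at this
    rw [zero_mul, add_zero]
    refine smul_left_injective ℂ (V_ne (rho θ φ)) ?_
    change _ • _ = _ • _
    rw [← hΦV, hcomm, coe_rho, hΦV, coe_rho, map_smul, smul_comm]
  refine ⟨V, fun φ => -h φ, (isCk_of_isCk_exp h_continuous exp_isCk).contDiff_comp contDiff_neg,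
    fun θ φ => congrArg Neg.neg (h_rho θ φ), fun φ => ?_⟩
  rw [hΦV, map_smul, Complex.ofReal_neg, neg_mul_neg, mul_comm]

end PhaseFactor

section SemiAutomorphism

variable {H : Type*} [NormedAddCommGroup H] [InnerProductSpace ℂ H] {k : ℕ∞}
  {Φ Ψ U ν : Equiv.Perm (State H)}

theorem IsInternalEquivalence.isSemiAutomorphism (hν : IsInternalEquivalence k ν) :
    IsSemiAutomorphism k ν :=
  ⟨hν.diffeo, hν.commutes, fun φ ψ h _ ha _ hb =>
    h _ (hν.orbit_into_itself φ ha) _ (hν.orbit_into_itself ψ hb)⟩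

theorem IsHilbertAutomorphism.isSemiAutomorphism (hU : IsHilbertAutomorphism k U) :
    IsSemiAutomorphism k U := by
  refine ⟨hU.diffeo, hU.commutes, ?_⟩
  rintro φ ψ h _ ⟨a, ha, rfl⟩ _ ⟨b, hb, rfl⟩
  exact hU.orthogonality a b (h a ha b hb)

theorem isSemiAutomorphism_one : IsSemiAutomorphism k (1 : Equiv.Perm (State H)) :=
  isSemiAutomorphism_iff.2
    ⟨⟨isCk_of_contDiff contDiff_id, isCk_of_contDiff contDiff_id⟩, fun _ _ => rfl, fun _ _ => id⟩

theorem IsSemiAutomorphism.mul (hΦ : IsSemiAutomorphism k Φ) (hΨ : IsSemiAutomorphism k Ψ) :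
    IsSemiAutomorphism k (Φ * Ψ) := by
  rw [isSemiAutomorphism_iff] at *
  exact ⟨hΦ.1.mul hΨ.1, hΦ.2.1.mul hΨ.2.1, fun φ ψ h => hΦ.2.2 _ _ (hΨ.2.2 φ ψ h)⟩

theorem IsSemiAutomorphism.inv [CompleteSpace H] (hH : 1 < Module.rank ℂ H) (hk : 1 ≤ k)
    (hΦ : IsSemiAutomorphism k Φ) : IsSemiAutomorphism k Φ⁻¹ := by
  obtain ⟨hdiffeo, hcomm, horth⟩ := isSemiAutomorphism_iff.1 hΦ
  have hk' : (1 : WithTop ℕ∞) ≤ k := by exact_mod_cast hk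
  refine isSemiAutomorphism_iff.2 ⟨⟨hdiffeo.2, hdiffeo.1⟩, fun θ φ => ?_, fun φ ψ h => ?_⟩
  · rw [Equiv.Perm.inv_eq_iff_eq, hcomm]
    exact congrArg (rho θ) (Φ.apply_symm_apply φ).symm
  · refine inner_eq_zero_of_inner_map_eq_zero hH (F := radialPerm Φ) radialExt_zero
      ((contDiffOn_radialExt hdiffeo.1).of_le hk') ((contDiffOn_radialExt hdiffeo.2).of_le hk')
      (fun _ _ => inner_radialExt_eq_zero horth) (Φ⁻¹ φ).coe_ne_zero ?_
    change inner ℂ (radialExt Φ (Φ.symm φ)) (radialExt Φ (Φ.symm ψ)) = 0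
    rwa [radialExt_coe, radialExt_coe, Φ.apply_symm_apply, Φ.apply_symm_apply]

theorem IsSemiAutomorphism.isOrthoMap [CompleteSpace H] (hH : 1 < Module.rank ℂ H) (hk : 1 ≤ k)
    (hΦ : IsSemiAutomorphism k Φ) : IsOrthoMap (radialExt Φ) where
  continuousOn := (contDiffOn_radialExt hΦ.diffeo.1).continuousOn
  map_smul := radialExt_smul hΦ.commutes
  norm_map := norm_radialExt
  inner_eq_zero_iff v w := by
    refine ⟨fun h => ?_, inner_radialExt_eq_zero (isSemiAutomorphism_iff.1 hΦ).2.2⟩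
    have h_inv := inner_radialExt_eq_zero (isSemiAutomorphism_iff.1 (hΦ.inv hH hk)).2.2 h
    have h_left : Function.LeftInverse (radialExt (⇑Φ⁻¹)) (radialExt Φ) :=
      radialExt_leftInverse Φ.left_inv
    rwa [h_left v, h_left w] at h_inv
  surjective := (radialPerm Φ).surjective

theorem IsSemiAutomorphism.isUnitaryType_or_isAntiunitaryType [CompleteSpace H]
    (hH : 2 < Module.rank ℂ H) (hk : 1 ≤ k) (hΦ : IsSemiAutomorphism k Φ) :
    IsUnitaryType Φ ∨ IsAntiunitaryType Φ := by
  refine ((hΦ.isOrthoMap (Cardinal.one_lt_two.trans hH) hk).unitary_or_antiunitary hH).imp ?_ ?_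
  all_goals
    rintro ⟨V, hV⟩
    exact ⟨V, fun φ => by simpa using hV φ⟩

theorem IsSemiAutomorphism.not_isAntiunitaryType (hH : 1 < Module.rank ℂ H)
    (hΦ : IsSemiAutomorphism k Φ) : ¬ IsAntiunitaryType Φ :=
  HiddenPhase.not_isAntiunitaryType hH (continuous_induced_rng.2 hΦ.diffeo.1.continuous)
    hΦ.commutes

theorem IsSemiAutomorphism.isUnitaryType [CompleteSpace H] (hH : 2 < Module.rank ℂ H)
    (hk : 1 ≤ k) (hΦ : IsSemiAutomorphism k Φ) : IsUnitaryType Φ :=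
  (hΦ.isUnitaryType_or_isAntiunitaryType hH hk).resolve_right
    (hΦ.not_isAntiunitaryType (Cardinal.one_lt_two.trans hH))

theorem eq_ofUnitary_mul_ofPhase_iff {V : H ≃ₗᵢ[ℂ] H} {h : State H → ℝ}
    (hh : ∀ θ φ, h (rho θ φ) = h φ) : Φ = ofUnitary V * ofPhase h hh ↔
      ∀ φ : State H, (Φ φ : H) = V (Complex.exp (-Complex.I * (h φ : ℂ)) • (φ : H)) := by
  simp only [Equiv.ext_iff, Subtype.ext_iff, Equiv.Perm.mul_apply, coe_ofUnitary, coe_ofPhase]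

theorem isSemiAutomorphism_iff_exists_phase [CompleteSpace H] (hH : 2 < Module.rank ℂ H)
    (hk : 1 ≤ k) : IsSemiAutomorphism k Φ ↔
      ∃ (V : H ≃ₗᵢ[ℂ] H) (h : State H → ℝ), IsCk k h ∧
        (∀ (θ : ℝ) (φ : State H), h (rho θ φ) = h φ) ∧
        ∀ φ : State H, (Φ φ : H) = V (Complex.exp (-Complex.I * (h φ : ℂ)) • (φ : H)) := by
  refine ⟨fun hΦ => (hΦ.isUnitaryType hH hk).exists_phase (Cardinal.one_lt_two.trans hH) hΦ.diffeo.1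
    hΦ.commutes, fun ⟨V, h, h_isCk, hh, hΦ⟩ => ?_⟩
  rw [(eq_ofUnitary_mul_ofPhase_iff hh).2 hΦ]
  exact (isHilbertAutomorphism_ofUnitary V).isSemiAutomorphism.mul
    (isInternalEquivalence_ofPhase hh h_isCk).isSemiAutomorphism

theorem isSemiAutomorphism_iff_exists_eq_comp [CompleteSpace H] (hH : 2 < Module.rank ℂ H)
    (hk : 1 ≤ k) : IsSemiAutomorphism k Φ ↔
      ∃ U ν : Equiv.Perm (State H),
        IsHilbertAutomorphism k U ∧ IsInternalEquivalence k ν ∧ (Φ : _ → _) = U ∘ ν := by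
  constructor
  · intro hΦ
    obtain ⟨V, h, h_isCk, hh, hV⟩ := (isSemiAutomorphism_iff_exists_phase hH hk).1 hΦ
    exact ⟨ofUnitary V, ofPhase h hh, isHilbertAutomorphism_ofUnitary V,
      isInternalEquivalence_ofPhase hh h_isCk,
      congrArg DFunLike.coe ((eq_ofUnitary_mul_ofPhase_iff hh).2 hV)⟩
  · rintro ⟨U, ν, hU, hν, h⟩
    obtain rfl : Φ = U * ν := DFunLike.coe_injective h
    exact hU.isSemiAutomorphism.mul hν.isSemiAutomorphism

/-- The group `ΘAut(𝕊)` of semi-automorphisms. Closure under inversion is a theorem, since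
semi-automorphisms are only assumed to preserve orthogonality in one direction. -/
def semiAutomorphismGroup [CompleteSpace H] (hH : 1 < Module.rank ℂ H) (hk : 1 ≤ k) :
    Subgroup (Equiv.Perm (State H)) where
  carrier := {Φ | IsSemiAutomorphism k Φ}
  mul_mem' := IsSemiAutomorphism.mul
  one_mem' := isSemiAutomorphism_one
  inv_mem' := IsSemiAutomorphism.inv hH hk

theorem exists_eq_sq_mul_sq [CompleteSpace H] (hH : 2 < Module.rank ℂ H) (hk : 1 ≤ k)
    (Φ : semiAutomorphismGroup (Cardinal.one_lt_two.trans hH) hk) :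
    ∃ Ψ Γ : semiAutomorphismGroup (Cardinal.one_lt_two.trans hH) hk, Φ = Ψ ^ 2 * Γ ^ 2 := by
  obtain ⟨V, h, h_isCk, hh, hV⟩ := (isSemiAutomorphism_iff_exists_phase hH hk).1 Φ.2
  obtain ⟨W, rfl⟩ := exists_linearIsometryEquiv_sq_eq V
  have half_isCk : IsCk k fun φ => h φ / 2 := h_isCk.contDiff_comp (contDiff_id.div_const 2)
  refine ⟨⟨ofUnitary W, (isHilbertAutomorphism_ofUnitary W).isSemiAutomorphism⟩,
    ⟨ofPhase (fun φ => h φ / 2) fun θ φ => by rw [hh],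
      (isInternalEquivalence_ofPhase _ half_isCk).isSemiAutomorphism⟩, Subtype.ext ?_⟩
  rw [(eq_ofUnitary_mul_ofPhase_iff hh).2 hV, ofUnitary_mul, ← sq, ← ofPhase_div_two_sq hh]
  rfl

theorem isSign_iff_eq_one [CompleteSpace H] (hH : 2 < Module.rank ℂ H) (hk : 1 ≤ k)
    {σ : semiAutomorphismGroup (Cardinal.one_lt_two.trans hH) hk →* ℤˣ} : IsSign σ ↔ σ = 1 := by
  constructor
  · exact fun hσ => MonoidHom.ext fun Φ => (hσ Φ).2 (exists_eq_sq_mul_sq hH hk Φ)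
  · rintro rfl
    exact fun Φ => iff_of_true rfl (exists_eq_sq_mul_sq hH hk Φ)

theorem isAutomorphism_one_iff {E : Type*} [NormedAddCommGroup E] {Φ : Equiv.Perm (State E)}
    {Θ : Subgroup (Equiv.Perm (State E))} : IsAutomorphism (1 : Θ →* ℤˣ) Φ ↔ Φ ∈ Θ :=
  ⟨fun ⟨hΦ, _⟩ => hΦ, fun hΦ => ⟨hΦ, rfl⟩⟩

end SemiAutomorphism

end HiddenPhase

end

open HiddenPhase in
theorem mainTheorem9_general {H : Type*} [NormedAddCommGroup H] [InnerProductSpace ℂ H]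
    [CompleteSpace H] (hH : 2 < Module.rank ℂ H) (k : ℕ∞) (hk : 1 ≤ k) :
    ∃ Θ : Subgroup (Equiv.Perm (State H)),
      (∀ Φ, Φ ∈ Θ ↔ IsSemiAutomorphism k Φ) ∧
      ∃ σ : Θ →* ℤˣ,
        IsSign σ ∧
        (∀ τ : Θ →* ℤˣ, IsSign τ → τ = σ) ∧
        (∀ Φ : Θ,
          (σ Φ = 1 ↔ IsUnitaryType (Φ : Equiv.Perm (State H))) ∧
          (σ Φ = -1 ↔ IsAntiunitaryType (Φ : Equiv.Perm (State H)))) ∧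
        (∀ Φ : Equiv.Perm (State H), IsDiffeo k Φ →
          (IsAutomorphism σ Φ ↔
            ∃ U ν : Equiv.Perm (State H),
              IsHilbertAutomorphism k U ∧
              IsInternalEquivalence k ν ∧ (Φ : _ → _) = U ∘ ν)) ∧
        (∀ Φ : Equiv.Perm (State H), IsDiffeo k Φ →
          (IsAutomorphism σ Φ ↔
            ∃ (V : H ≃ₗᵢ[ℂ] H) (h : State H → ℝ),
              IsCk k h ∧
              (∀ (θ : ℝ) (φ : State H), h (rho θ φ) = h φ) ∧
              ∀ φ : State H,
                (Φ φ : H) = V (Complex.exp (-Complex.I * (h φ : ℂ)) • (φ : H)))) := by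
  refine ⟨semiAutomorphismGroup (Cardinal.one_lt_two.trans hH) hk, fun _ => Iff.rfl, 1,
    (isSign_iff_eq_one hH hk).2 rfl, fun τ hτ => (isSign_iff_eq_one hH hk).1 hτ,
    fun Φ => ⟨iff_of_true rfl (Φ.2.isUnitaryType hH hk), iff_of_false (by simp)
      (Φ.2.not_isAntiunitaryType (Cardinal.one_lt_two.trans hH))⟩, fun Φ _ => ?_, fun Φ _ => ?_⟩
  · exact isAutomorphism_one_iff.trans (isSemiAutomorphism_iff_exists_eq_comp hH hk)
  · exact isAutomorphism_one_iff.trans (isSemiAutomorphism_iff_exists_phase hH hk)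

theorem mainTheorem9 {H : Type*} [NormedAddCommGroup H] [InnerProductSpace ℂ H]
    [CompleteSpace H] (hH : ¬ FiniteDimensional ℂ H) (k : ℕ∞) (hk : 1 ≤ k) :
    ∃ Θ : Subgroup (Equiv.Perm (HiddenPhase.State H)),
      (∀ Φ, Φ ∈ Θ ↔ HiddenPhase.IsSemiAutomorphism k Φ) ∧
      ∃ σ : Θ →* ℤˣ,
        HiddenPhase.IsSign σ ∧
        (∀ τ : Θ →* ℤˣ, HiddenPhase.IsSign τ → τ = σ) ∧
        (∀ Φ : Θ,
          (σ Φ = 1 ↔ HiddenPhase.IsUnitaryType (Φ : Equiv.Perm (HiddenPhase.State H))) ∧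
          (σ Φ = -1 ↔ HiddenPhase.IsAntiunitaryType (Φ : Equiv.Perm (HiddenPhase.State H)))) ∧
        (∀ Φ : Equiv.Perm (HiddenPhase.State H), HiddenPhase.IsDiffeo k Φ →
          (HiddenPhase.IsAutomorphism σ Φ ↔
            ∃ U ν : Equiv.Perm (HiddenPhase.State H),
              HiddenPhase.IsHilbertAutomorphism k U ∧
              HiddenPhase.IsInternalEquivalence k ν ∧ (Φ : _ → _) = U ∘ ν)) ∧
        (∀ Φ : Equiv.Perm (HiddenPhase.State H), HiddenPhase.IsDiffeo k Φ →
          (HiddenPhase.IsAutomorphism σ Φ ↔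
            ∃ (V : H ≃ₗᵢ[ℂ] H) (h : HiddenPhase.State H → ℝ),
              HiddenPhase.IsCk k h ∧
              (∀ (θ : ℝ) (φ : HiddenPhase.State H), h (HiddenPhase.rho θ φ) = h φ) ∧
              ∀ φ : HiddenPhase.State H,
                (Φ φ : H) = V (Complex.exp (-Complex.I * (h φ : ℂ)) • (φ : H)))) := by
  have rank_infinite : Cardinal.aleph0 ≤ Module.rank ℂ H :=
    not_lt.1 (Module.rank_lt_aleph0_iff.not.2 hH)
  exact mainTheorem9_general ((Cardinal.natCast_lt_aleph0 (n := 2)).trans_le rank_infinite) k hk
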